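/- Let $f_0,f_1$ be probability densities with respect to a $\sigma$-finite measure $\nu$, with $I_0=\int \log(f_0/f_1)f_0\,d\nu\in(0,\infty)$ and $I_1=\int\log(f_1/f_0)f_1\,d\nu\in(0,\infty)$. Let $X_1,X_2,\dots$ be i.i.d. with density $f_i$ under $\mathsf P_i$, let $\Lambda_n=\sum_{k\le n}\log\big(f_1(X_k)/f_0(X_k)\big)$, $\bar\Lambda_n=\Lambda_n/n$, $\mathcal F_n=\sigma(X_1,\dots,X_n)$ and $\mathsf P_\pi=(1-\pi)\mathsf P_0+\pi\mathsf P_1$. A test is a pair $(T,D)$ of an almost surely finite stopping time $T\ge 1$ and an $\mathcal F_T$-measurable decision $D\in\{0,1\}$. Let $\mathcal E(\alpha,\beta)$ be the class of tests with $\mathsf P_0(D=1)\le\alpha$ and $\mathsf P_1(D=0)\le\beta$, and $\mathcal L_\pi(\alpha,\beta)=\inf_{(T,D)\in\mathcal E(\alpha,\beta)}\mathsf E_\pi[T]$. *The two tests.* For $\alpha,\beta\in(0,1)$ let $\mathsf{FSST}(\alpha,\beta)=(n^*,c^*)$, where $n^*$ is the least $n\ge1$ for which some $c\in\mathbb R$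 satisfies $\mathsf P_0(\bar\Lambda_n>c)\le\alpha$ and $\mathsf P_1(\bar\Lambda_n\le c)\le\beta$, and $c^*$ is the least such $c$ for $n=n^*$. Given $K\ge 1$, sample sizes $m_j\ge 0$ and thresholds $b_j$ ($1\le j\le K$), put $M_j=m_1+\dots+m_j$. The test takes $m_j$ observations in stage $j$; it stops and accepts the null hypothesis after the first stage $j$ with $\Lambda'_j\le b_j$, and it rejects the null hypothesis after stage $K$ if there is no such stage. - Sequential Thresholding (ST): $\Lambda_j'=(\Lambda_{M_j}-\Lambda_{M_{j-1}})/m_j$, $(m_1,b_1)=\mathsf{FSST}\big(\alpha^{1/K},\beta-\sum_{j=2}^K(\beta/2)^j\big)$ and $(m_j,b_j)=\mathsf{FSST}\big(\alpha^{1/K},(\beta/2)^j\big)$ for $2\le j\le K$. - Modified ST (mod-ST): $\Lambda_j'=\bar\Lambda_{M_j}$, $(m_1,b_1)$ as for ST and, for $2\le j\le K$, recursively, $m_j$ is the least integer $n\ge0$ for which some $b\in\mathbb R$ satisfies $\mathsf P_0\big(\bar\Lambda_{M_{j-1}+n}>b,\ \bar\Lambda_{M_i}>b_i\ \forall i<j\big)\le\alpha^{j/K}$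 and $\mathsf P_1\big(\bar\Lambda_{M_{j-1}+n}\le b\big)\le(\beta/2)^j$; and $b_j$ is the infimum of such $b$ for $n=m_j$ (with $b_j=-\infty$ if they are unbounded below). Let $K=K(\alpha,\beta)\ge1$ be an integer-valued function on $(0,1)^2$. We call it admissible if $\alpha^{1/K}\to0$ and $|\log\alpha^{1/K}|\ll|\log\beta|$ as $\alpha,\beta\to0$ (at arbitrary rates). Let $\chi'_K$ and $\chi''_K$ be the families of ST and mod-ST, indexed by $\alpha,\beta\in(0,1)$, with $K=K(\alpha,\beta)$ stages. *High-dimensional regime.* For $m\ge1$ let $l_m,u_m$ be integers with $0\le l_m\le u_m\le m$, $u_m>0$, $l_m<m$. For $\alpha,\beta\in(0,1)$ let $\alpha_m=1-(1-\alpha)^{1/(m-l_m)}$ and $\beta_m=1-(1-\beta)^{1/u_m}$. A family of tests $(T^*(\alpha,\beta),D^*(\alpha,\beta))\in\mathcal E(\alpha,\beta)$, $\alpha,\beta\in(0,1)$, is asymptotically optimal in the high-dimensional sense if for all $\alpha,\beta\in(0,1)$ $$\max_{l_m\le s\le u_m}\frac{\mathsf E_{s/m}[T^*(\alpha_m,\beta_m)]}{\mathcal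 L_{s/m}(\alpha_m,\beta_m)}\longrightarrow1\qquad(m\to\infty).$$ **Corollary.** Suppose that $u_m\to\infty$ and $u_m\ll m$ as $m\to\infty$. (i) For all $\alpha,\beta\in(0,1)$, $\mathcal L_{s/m}(\alpha_m,\beta_m)\sim \dfrac{\log u_m}{I_0}$ uniformly in $s\in\{l_m,\dots,u_m\}$. (ii) Write $K_m=K(\alpha_m,\beta_m)$. For every admissible $K$ such that $K_m\ll\sqrt{m/u_m}$ for all $\alpha,\beta\in(0,1)$, the family $\chi'_K$ is asymptotically optimal in the high-dimensional sense. For every admissible $K$ such that $K_m\ll m/u_m$ for all $\alpha,\beta\in(0,1)$, so is $\chi''_K$. Moreover, there is an admissible $K$ with $K_m\ll\sqrt{m/u_m}$ for all $\alpha,\beta\in(0,1)$, and for it both $\chi'_K$ and $\chi''_K$ are asymptotically optimal in the high-dimensional sense. -/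

import Mathlib

open Filter Topology MeasureTheory Set
open scoped NNReal ENNReal

noncomputable section

/-- The data of the binary testing problem `H₀ : f = f 0` versus `H₁ : f = f 1`: two probability
densities with respect to a common `σ`-finite measure `ν`. -/
structure TestingProblem (𝓧 : Type*) [MeasurableSpace 𝓧] where
  ν : Measure 𝓧
  f : Fin 2 → 𝓧 → ℝ≥0
  sigmaFinite : SigmaFinite ν
  measurable_f : ∀ i, Measurable (f i)
  lintegral_f : ∀ i, ∫⁻ x, (f i x : ℝ≥0∞) ∂ν = 1

/-- A pair `(T, D)` of a random time and a decision, as functions of the sequence of observations.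
The observation `X_{k+1}` is the coordinate `ω k`. -/
abbrev TimeDecision (𝓧 : Type*) := ((ℕ → 𝓧) → ℕ∞) × ((ℕ → 𝓧) → Fin 2)

namespace TestingProblem

variable {𝓧 : Type*} [MeasurableSpace 𝓧] (B : TestingProblem 𝓧)

/-- The law of one observation under `H_i`. -/
def law (i : Fin 2) : Measure 𝓧 := B.ν.withDensity (fun x => (B.f i x : ℝ≥0∞))

instance (i : Fin 2) : IsProbabilityMeasure (B.law i) :=
  ⟨by rw [law, withDensity_apply _ MeasurableSet.univ, Measure.restrict_univ, B.lintegral_f i]⟩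

/-- `P i`: the law of the i.i.d. sequence of observations under `H_i`. -/
def P (i : Fin 2) : Measure (ℕ → 𝓧) := Measure.infinitePi (fun _ : ℕ => B.law i)

/-- The Kullback-Leibler divergence of `f (1 - i)` from `f i`: this is `I_0` for `i = 0` and `I_1`
for `i = 1`. It is `∞` if the log-likelihood ratio fails to be defined or integrable. -/
def klInfo (i : Fin 2) : ℝ≥0∞ := InformationTheory.klDiv (B.law i) (B.law (1 - i))

/-- `F_n`, the `σ`-algebra generated by the first `n` observations. -/
abbrev past (𝓧 : Type*) [MeasurableSpace 𝓧] (n : ℕ) : MeasurableSpace (ℕ → 𝓧) :=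
  MeasurableSpace.comap (fun (ω : ℕ → 𝓧) (k : Fin n) => ω k) inferInstance

/-- The log-likelihood ratio `Λ_n` of the first `n` observations. -/
def llr (n : ℕ) (ω : ℕ → 𝓧) : ℝ :=
  ∑ k ∈ Finset.range n, Real.log ((B.f 1 (ω k) : ℝ) / (B.f 0 (ω k) : ℝ))

/-- The average log-likelihood ratio `Λ_n / n`. -/
def avgLlr (n : ℕ) (ω : ℕ → 𝓧) : ℝ := B.llr n ω / n

/-- Sequential tests: `T` takes values in the positive integers, is almost surely finite under both
hypotheses, and stopping at time `n` with decision `i` is determined by the first `n`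
observations. -/
structure IsTest (τ : TimeDecision 𝓧) : Prop where
  one_le : ∀ ω, 1 ≤ τ.1 ω
  ae_finite : ∀ i, ∀ᵐ ω ∂(B.P i), τ.1 ω ≠ ⊤
  measurable_decision : Measurable τ.2
  adapted_time : ∀ n : ℕ, 1 ≤ n → MeasurableSet[past 𝓧 n] {ω | τ.1 ω = n}
  adapted_decision : ∀ n : ℕ, 1 ≤ n → ∀ i : Fin 2,
    MeasurableSet[past 𝓧 n] {ω | τ.1 ω = n ∧ τ.2 ω = i}

/-- The class `𝓔(α, β)` of tests with type-I error at most `α` and type-II error at most `β`. -/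
def testClass (α β : ℝ) : Set (TimeDecision 𝓧) :=
  {τ | B.IsTest τ ∧ (B.P 0).real {ω | τ.2 ω = 1} ≤ α ∧ (B.P 1).real {ω | τ.2 ω = 0} ≤ β}

/-- The mixture `P_π = (1 - π) P_0 + π P_1`, for `π ∈ [0, 1]`. -/
def mix (π : ℝ) : Measure (ℕ → 𝓧) :=
  ENNReal.ofReal (1 - π) • B.P 0 + ENNReal.ofReal π • B.P 1

/-- The expected sample size `E_π[T]`. -/
def ess (π : ℝ) (T : (ℕ → 𝓧) → ℕ∞) : ℝ≥0∞ := ∫⁻ ω, (T ω : ℝ≥0∞) ∂(B.mix π)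

/-- The optimal expected sample size `𝓛_π(α, β)`. -/
def optEss (π α β : ℝ) : ℝ≥0∞ := ⨅ τ ∈ B.testClass α β, B.ess π τ.1

/-! ### The fixed-sample-size test -/

/-- `n*(α, β)`. -/
def fssSize (α β : ℝ) : ℕ :=
  sInf {n : ℕ | 1 ≤ n ∧ ∃ c : ℝ,
    (B.P 0).real {ω | c < B.avgLlr n ω} ≤ α ∧ (B.P 1).real {ω | B.avgLlr n ω ≤ c} ≤ β}

/-- `c*(α, β)`, the least threshold. -/
def fssThr (α β : ℝ) : EReal :=
  sInf {c : EReal |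
    (B.P 0).real {ω | c < (B.avgLlr (B.fssSize α β) ω : EReal)} ≤ α ∧
    (B.P 1).real {ω | (B.avgLlr (B.fssSize α β) ω : EReal) ≤ c} ≤ β}

/-! ### Sequential Thresholding and its modification

Stages are numbered `1, …, K`. -/

/-- The type-II error probability assigned to stage `j`. -/
def stageBeta (K : ℕ) (β : ℝ) (j : ℕ) : ℝ :=
  if j = 1 then β - ∑ i ∈ Finset.Icc 2 K, (β / 2) ^ i else (β / 2) ^ j

/-- The test with at most `K` stages which, after stage `j` (that is, after `M j` observations in
total) stops and accepts `H₀` if the statistic `S j` does not exceed the threshold `b j`, and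
rejects `H₀` if this does not happen in any of the `K` stages. -/
def thresholding (K : ℕ) (M : ℕ → ℕ) (b : ℕ → EReal) (S : ℕ → (ℕ → 𝓧) → ℝ) : TimeDecision 𝓧 :=
  (fun ω => (M (sInf {j : ℕ | 1 ≤ j ∧ (j = K ∨ (S j ω : EReal) ≤ b j)}) : ℕ∞),
   open Classical in
   fun ω => if ∀ j ∈ Finset.Icc 1 K, b j < (S j ω : EReal) then 1 else 0)

/-- The size `m_j` of stage `j` of ST. -/
def stSize (K : ℕ) (α β : ℝ) (j : ℕ) : ℕ :=
  B.fssSize (α ^ (1 / (K : ℝ))) (stageBeta K β j)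

/-- The threshold `b_j` of stage `j` of ST. -/
def stThr (K : ℕ) (α β : ℝ) (j : ℕ) : EReal :=
  B.fssThr (α ^ (1 / (K : ℝ))) (stageBeta K β j)

/-- `M_j = m_1 + ⋯ + m_j` for ST. -/
def stTotal (K : ℕ) (α β : ℝ) (j : ℕ) : ℕ := ∑ i ∈ Finset.Icc 1 j, B.stSize K α β i

/-- Sequential Thresholding (ST) with `K` stages; the statistic of stage `j` is the average
log-likelihood ratio of the observations of stage `j` only. -/
def stTest (K : ℕ) (α β : ℝ) : TimeDecision 𝓧 :=
  thresholding K (B.stTotal K α β) (B.stThr K α β)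
    (fun j ω => (B.llr (B.stTotal K α β j) ω - B.llr (B.stTotal K α β (j - 1)) ω) /
      (B.stSize K α β j : ℝ))

/-- State after a stage of mod-ST: the total sample size `M_j`, the threshold `b_j` and the event
`⋂_{i ≤ j} {avgLlr M_i > b_i}` that the test has not accepted `H₀` in the first `j` stages. -/
structure StageState (𝓧 : Type*) where
  total : ℕ
  thr : EReal
  passed : Set (ℕ → 𝓧)

/-- The least number `n ≥ 0` of further observations for which some threshold meets the error
constraints `a` and `b`, after `M` observations and on the event `A`. -/
def nextSize (M : ℕ) (A : Set (ℕ → 𝓧)) (a b : ℝ) : ℕ :=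
  sInf {n : ℕ | ∃ c : ℝ,
    (B.P 0).real ({ω | c < B.avgLlr (M + n) ω} ∩ A) ≤ a ∧
    (B.P 1).real {ω | B.avgLlr (M + n) ω ≤ c} ≤ b}

/-- The least threshold that meets the error constraints `a` and `b` with `M` observations and on
the event `A`. It is `-∞` if the constraint under `H₀` is void, so that all small thresholds
qualify. -/
def nextThr (M : ℕ) (A : Set (ℕ → 𝓧)) (a b : ℝ) : EReal :=
  sInf {c : EReal |
    (B.P 0).real ({ω | c < (B.avgLlr M ω : EReal)} ∩ A) ≤ a ∧
    (B.P 1).real {ω | (B.avgLlr M ω : EReal) ≤ c} ≤ b}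

/-- The recursive specification of mod-ST: after the first stage, which is that of ST, stage `j` has
the levels `α ^ (j / K)` and `(β / 2) ^ j`. -/
def modStage (K : ℕ) (α β : ℝ) : ℕ → StageState 𝓧
  | 0 => ⟨0, ⊥, univ⟩
  | 1 => ⟨B.stSize K α β 1, B.stThr K α β 1,
      {ω | B.stThr K α β 1 < (B.avgLlr (B.stSize K α β 1) ω : EReal)}⟩
  | j + 2 =>
    let s := modStage K α β (j + 1)
    let a : ℝ := α ^ (((j + 2 : ℕ) : ℝ) / (K : ℝ))
    let M : ℕ := s.total + B.nextSize s.total s.passed a (stageBeta K β (j + 2))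
    let c : EReal := B.nextThr M s.passed a (stageBeta K β (j + 2))
    ⟨M, c, {ω | c < (B.avgLlr M ω : EReal)} ∩ s.passed⟩

/-- Modified Sequential Thresholding (mod-ST) with `K` stages; the statistic of stage `j` is the
average log-likelihood ratio of all observations collected so far. -/
def modStTest (K : ℕ) (α β : ℝ) : TimeDecision 𝓧 :=
  thresholding K (fun j => (B.modStage K α β j).total) (fun j => (B.modStage K α β j).thr)
    (fun j => B.avgLlr (B.modStage K α β j).total)

end TestingProblem

/-- The condition on the number of stages as a function of `α` and `β`: `K ≥ 1`, and
`α ^ (1 / K) → 0` and `|log α ^ (1 / K)| ≪ |log β|` as `α, β → 0` at arbitrary rates. -/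
def AdmissibleStages (K : ℝ → ℝ → ℕ) : Prop :=
  (∀ α ∈ Ioo (0 : ℝ) 1, ∀ β ∈ Ioo (0 : ℝ) 1, 1 ≤ K α β) ∧
  Tendsto (fun p : ℝ × ℝ => p.1 ^ (1 / (K p.1 p.2 : ℝ))) (𝓝[>] 0 ×ˢ 𝓝[>] 0) (𝓝 0) ∧
  Tendsto (fun p : ℝ × ℝ => |Real.log (p.1 ^ (1 / (K p.1 p.2 : ℝ)))| / |Real.log p.2|)
    (𝓝[>] 0 ×ˢ 𝓝[>] 0) (𝓝 0)

/-- `α_m = 1 - (1 - α) ^ (1 / (m - l_m))`. -/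
def alphaM (l : ℕ → ℕ) (α : ℝ) (m : ℕ) : ℝ := 1 - (1 - α) ^ (1 / ((m : ℝ) - (l m : ℝ)))

/-- `β_m = 1 - (1 - β) ^ (1 / u_m)`. -/
def betaM (u : ℕ → ℕ) (β : ℝ) (m : ℕ) : ℝ := 1 - (1 - β) ^ (1 / (u m : ℝ))

/-- `x m s ∼ y m s` as `m → ∞`, uniformly in `s ∈ {l m, …, u m}`. -/
def UniformlyEquivalent (l u : ℕ → ℕ) (x y : ℕ → ℕ → ℝ≥0∞) : Prop :=
  ∀ ε : ℝ, 0 < ε → ∀ᶠ m in atTop, ∀ s ∈ Finset.Icc (l m) (u m),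
    ENNReal.ofReal (1 - ε) ≤ x m s / y m s ∧ x m s / y m s ≤ ENNReal.ofReal (1 + ε)

/-- Asymptotic optimality in the high-dimensional sense of a family of tests
`χ α β ∈ 𝓔(α, β)`, `α, β ∈ (0, 1)`. -/
def HighDimOptimal {𝓧 : Type*} [MeasurableSpace 𝓧] (B : TestingProblem 𝓧) (l u : ℕ → ℕ)
    (χ : ℝ → ℝ → TimeDecision 𝓧) : Prop :=
  (∀ α ∈ Ioo (0 : ℝ) 1, ∀ β ∈ Ioo (0 : ℝ) 1, χ α β ∈ B.testClass α β) ∧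
  ∀ α ∈ Ioo (0 : ℝ) 1, ∀ β ∈ Ioo (0 : ℝ) 1,
    Tendsto (fun m : ℕ => (Finset.Icc (l m) (u m)).sup (fun s : ℕ =>
      B.ess ((s : ℝ) / m) (χ (alphaM l α m) (betaM u β m)).1 /
        B.optEss ((s : ℝ) / m) (alphaM l α m) (betaM u β m))) atTop (𝓝 1)

end

set_option linter.unusedSectionVars false

/-! Every expected sample size is compared with `log u_m / I_0`. Since `s / m ≤ u_m / m → 0`, the
mixture is essentially `P_0`, while `-log β_m ∼ log u_m`.

Lower bound (`le_ess_of_mem_testClass`, `eventually_le_optEss`). Take `n ≈ log u_m / J₂` with `I_0 <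
J₁ < J₂`. A test that stops by time `n` either rejects, which has `P_0`-probability at most `α_m →
0`, or accepts. On `Λ_n ≥ -J₁ n`, which has `P_0`-probability tending to `1` by the law of large
numbers, a change of measure bounds the probability of acceptance by `exp (J₁ n) β_m = O(u_m ^ (J₁ /
J₂ - 1))`. Hence `T > n` with `P_0`-probability tending to `1`.

Upper bound (`exists_separatesAt`, `eventually_ess_le`). For `J < I_0` the threshold `-J` has
type-II error at most `exp (-J n)`, because `exp (-Λ_n)` has `P_1`-mean `1`, and type-I error at
most `exp (-κ n)` for some `κ > 0` by Chernoff. Admissibility makes the type-I constraint cheap, so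
with `L = |log (β / 2)| / J` about `j L` observations meet the levels of stage `j`. Put `a = α ^ (1
/ K)`. Under `P_0`, stage `j` is reached with probability at most `a ^ (j - 1)`, so the expected
sample size is at most `(L + 1)(1 + 8 a)`. Under `P_1` the crude bound `M_K ≤ K ^ q (L + 1)` is
enough: `q = 2` for ST, whose stages use fresh data, and `q = 1` for mod-ST, which keeps all data.
The term `(u_m / m) K_m ^ q` vanishes exactly under the stated growth conditions.

Existence (`exists_admissibleStages`). A choice `K ≈ (1 + |log α| / |log β|) g` with `g → ∞` slowly
is admissible. Along `(α_m, β_m)` the ratio of logarithms is `O(1 + log (m / u_m))`, so `K_m ≪ √(m /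
u_m)` if `g` grows slowly enough. -/

/-! ### Moment generating functions near the origin -/

/-- If `exp X` is integrable, the mean of `X` is the right derivative of its moment generating
function at `0`; hence the moment generating function is less than `exp (θ c)` for small positive
`θ` when `c` exceeds the mean. -/
lemma exists_mgf_le_exp {Ω : Type*} {mΩ : MeasurableSpace Ω} {μ : Measure Ω}
    [IsProbabilityMeasure μ] {X : Ω → ℝ} (hX : Integrable X μ)
    (hexp : Integrable (fun ω => Real.exp (X ω)) μ) {c : ℝ} (hc : ∫ ω, X ω ∂μ < c) :
    ∃ θ : ℝ, 0 < θ ∧ θ ≤ 1 ∧ Integrable (fun ω => Real.exp (θ * X ω)) μ ∧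
      ProbabilityTheory.mgf X μ θ ≤ Real.exp (θ * c) := by
  -- Convexity between `0` and `x`; it yields integrability of `exp (θ X)` and the upper half of the
  -- dominating bound below.
  have hconv : ∀ θ ∈ Ioc (0 : ℝ) 1, ∀ x : ℝ, Real.exp (θ * x) ≤ 1 + θ * (Real.exp x - 1) := by
    intro θ hθ x
    have := convexOn_exp.2 (mem_univ x) (mem_univ 0) hθ.1.le (sub_nonneg.2 hθ.2) (by ring)
    simp only [smul_eq_mul, mul_zero, add_zero, Real.exp_zero, mul_one] at this
    linarith
  have hint : ∀ θ ∈ Ioc (0 : ℝ) 1, Integrable (fun ω => Real.exp (θ * X ω)) μ := by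
    intro θ hθ
    refine Integrable.mono' (g := fun ω => 1 + θ * (Real.exp (X ω) - 1))
      ((integrable_const _).add ((hexp.sub (integrable_const _)).const_mul θ))
      (Real.continuous_exp.comp_aestronglyMeasurable (hX.1.const_mul θ)) (ae_of_all _ fun ω => ?_)
    rw [Real.norm_of_nonneg (Real.exp_pos _).le]
    exact hconv θ hθ _
  -- The difference quotients lie between `X` and `exp X - 1`, both integrable, so dominated
  -- convergence applies.
  have hlim : Tendsto (fun n : ℕ => ∫ ω, (Real.exp (1 / ((n : ℝ) + 1) * X ω) - 1) /
      (1 / ((n : ℝ) + 1)) ∂μ) atTop (𝓝 (∫ ω, X ω ∂μ)) := by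
    refine tendsto_integral_of_dominated_convergence (fun ω => |X ω| + (Real.exp (X ω) + 1)) ?_ ?_
      ?_ ?_
    · intro n
      have := hX.aemeasurable
      exact AEMeasurable.aestronglyMeasurable (by fun_prop)
    · exact hX.abs.add (hexp.add (integrable_const _))
    · intro n
      refine ae_of_all _ fun ω => ?_
      have hθ : (1 / ((n : ℝ) + 1)) ∈ Ioc (0 : ℝ) 1 :=
        ⟨by positivity, by rw [div_le_one (by positivity)]; linarith [n.cast_nonneg (α := ℝ)]⟩
      set θ := 1 / ((n : ℝ) + 1)
      have h1 : (Real.exp (θ * X ω) - 1) / θ ≤ Real.exp (X ω) - 1 := by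
        rw [div_le_iff₀ hθ.1]; linarith [hconv θ hθ (X ω)]
      have h2 : X ω ≤ (Real.exp (θ * X ω) - 1) / θ := by
        rw [le_div_iff₀ hθ.1]; linarith [Real.add_one_le_exp (θ * X ω)]
      rw [Real.norm_eq_abs, abs_le]
      constructor <;> linarith [neg_abs_le (X ω), abs_nonneg (X ω), Real.exp_pos (X ω)]
    · refine ae_of_all _ fun ω => ?_
      have hd : HasDerivAt (fun t : ℝ => Real.exp (t * X ω)) (X ω) 0 := by
        simpa using ((hasDerivAt_id (0 : ℝ)).mul_const (X ω)).exp
      have := (hasDerivAt_iff_tendsto_slope_zero.1 hd).comp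
        (tendsto_nhdsWithin_iff.2 ⟨tendsto_one_div_add_atTop_nhds_zero_nat (𝕜 := ℝ),
          Eventually.of_forall fun n => by
            have : (0 : ℝ) < 1 / ((n : ℝ) + 1) := by positivity
            exact this.ne'⟩)
      refine this.congr fun n => ?_
      simp [div_eq_inv_mul, Function.comp]
  obtain ⟨n, hn⟩ := (hlim.eventually (gt_mem_nhds hc)).exists
  have hθ : (1 / ((n : ℝ) + 1)) ∈ Ioc (0 : ℝ) 1 :=
    ⟨by positivity, by rw [div_le_one (by positivity)]; linarith [n.cast_nonneg (α := ℝ)]⟩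
  set θ := 1 / ((n : ℝ) + 1)
  refine ⟨θ, hθ.1, hθ.2, hint θ hθ, ?_⟩
  rw [integral_div, integral_sub (hint θ hθ) (integrable_const _), div_lt_iff₀ hθ.1] at hn
  simp only [integral_const, probReal_univ, smul_eq_mul, mul_one] at hn
  have := Real.add_one_le_exp (θ * c)
  rw [ProbabilityTheory.mgf]
  linarith

namespace TestingProblem

variable {𝓧 : Type*} [MeasurableSpace 𝓧] (B : TestingProblem 𝓧)

/-! ### One observation -/

/-- The log-likelihood ratio of one observation. -/
noncomputable def logRatio (x : 𝓧) : ℝ := Real.log ((B.f 1 x : ℝ) / (B.f 0 x : ℝ))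

@[fun_prop]
lemma measurable_logRatio : Measurable B.logRatio :=
  Real.measurable_log.comp ((B.measurable_f 1).coe_nnreal_real.div
    (B.measurable_f 0).coe_nnreal_real)

lemma ae_ne_zero (i : Fin 2) : ∀ᵐ x ∂(B.law i), B.f i x ≠ 0 := by
  rw [law, ae_withDensity_iff (B.measurable_f i).coe_nnreal_ennreal]
  exact ae_of_all _ fun x hx => by simpa using hx

variable {B}

lemma absolutelyContinuous_law (hI : ∀ i, 0 < B.klInfo i ∧ B.klInfo i < ∞) :
    B.law 0 ≪ B.law 1 ∧ B.law 1 ≪ B.law 0 :=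
  ⟨(InformationTheory.klDiv_ne_top_iff.1 (hI 0).2.ne).1,
    (InformationTheory.klDiv_ne_top_iff.1 (hI 1).2.ne).1⟩

/-- Finite divergences in both directions force mutual absolute continuity. Hence the default values
of `Real.log` and of division by zero in `logRatio` matter only where both densities vanish. -/
lemma ae_zero_iff_zero (hI : ∀ i, 0 < B.klInfo i ∧ B.klInfo i < ∞) :
    ∀ᵐ x ∂B.ν, B.f 0 x = 0 ↔ B.f 1 x = 0 := by
  have h0 := (absolutelyContinuous_law hI).1 (B.ae_ne_zero 1)
  have h1 := (absolutelyContinuous_law hI).2 (B.ae_ne_zero 0)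
  have h0' : ∀ᵐ x ∂(B.law 0), B.f 1 x ≠ 0 := h0
  have h1' : ∀ᵐ x ∂(B.law 1), B.f 0 x ≠ 0 := h1
  rw [law, ae_withDensity_iff (B.measurable_f _).coe_nnreal_ennreal] at h0' h1'
  filter_upwards [h0', h1'] with x hx0 hx1
  simp only [ne_eq, ENNReal.coe_eq_zero] at hx0 hx1
  tauto

lemma law_one_eq (hI : ∀ i, 0 < B.klInfo i ∧ B.klInfo i < ∞) :
    B.law 1 = (B.law 0).withDensity (fun x => ENNReal.ofReal (Real.exp (B.logRatio x))) := by
  rw [law, law, ← withDensity_mul _ (B.measurable_f 0).coe_nnreal_ennreal (by fun_prop)]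
  refine withDensity_congr_ae ?_
  filter_upwards [ae_zero_iff_zero hI] with x hx
  rcases eq_or_ne (B.f 0 x) 0 with h | h
  · simp [h, hx.1 h]
  · have h1 : B.f 1 x ≠ 0 := fun h' => h (hx.2 h')
    have h0 : (0 : ℝ) < B.f 0 x := by positivity
    have h1 : (0 : ℝ) < B.f 1 x := by positivity
    rw [Pi.mul_apply, logRatio, Real.exp_log (by positivity), ← ENNReal.ofReal_coe_nnreal,
      ← ENNReal.ofReal_coe_nnreal, ← ENNReal.ofReal_mul h0.le, mul_div_cancel₀ _ h0.ne']

lemma law_zero_eq (hI : ∀ i, 0 < B.klInfo i ∧ B.klInfo i < ∞) :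
    B.law 0 = (B.law 1).withDensity (fun x => ENNReal.ofReal (Real.exp (-B.logRatio x))) := by
  rw [law_one_eq hI, ← withDensity_mul _ (by fun_prop) (by fun_prop)]
  conv_lhs => rw [← withDensity_one (μ := B.law 0)]
  congr 1
  ext x
  rw [Pi.mul_apply, ← ENNReal.ofReal_mul (Real.exp_pos _).le, ← Real.exp_add]
  simp

lemma lintegral_exp_logRatio (hI : ∀ i, 0 < B.klInfo i ∧ B.klInfo i < ∞) :
    ∫⁻ x, ENNReal.ofReal (Real.exp (B.logRatio x)) ∂(B.law 0) = 1 := by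
  rw [← setLIntegral_univ, ← withDensity_apply _ MeasurableSet.univ, ← law_one_eq hI, measure_univ]

lemma lintegral_exp_neg_logRatio (hI : ∀ i, 0 < B.klInfo i ∧ B.klInfo i < ∞) :
    ∫⁻ x, ENNReal.ofReal (Real.exp (-B.logRatio x)) ∂(B.law 1) = 1 := by
  rw [← setLIntegral_univ, ← withDensity_apply _ MeasurableSet.univ, ← law_zero_eq hI, measure_univ]

lemma integrable_exp_logRatio (hI : ∀ i, 0 < B.klInfo i ∧ B.klInfo i < ∞) :
    Integrable (fun x => Real.exp (B.logRatio x)) (B.law 0) :=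
  (lintegral_ofReal_ne_top_iff_integrable (by fun_prop)
    (ae_of_all _ fun x => (Real.exp_pos _).le)).1 (by simp [lintegral_exp_logRatio hI])

lemma integrable_exp_neg_logRatio (hI : ∀ i, 0 < B.klInfo i ∧ B.klInfo i < ∞) :
    Integrable (fun x => Real.exp (-B.logRatio x)) (B.law 1) :=
  (lintegral_ofReal_ne_top_iff_integrable (by fun_prop)
    (ae_of_all _ fun x => (Real.exp_pos _).le)).1 (by simp [lintegral_exp_neg_logRatio hI])

lemma integral_exp_neg_logRatio (hI : ∀ i, 0 < B.klInfo i ∧ B.klInfo i < ∞) :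
    ∫ x, Real.exp (-B.logRatio x) ∂(B.law 1) = 1 := by
  rw [integral_eq_lintegral_of_nonneg_ae (ae_of_all _ fun x => (Real.exp_pos _).le)
    (by fun_prop), lintegral_exp_neg_logRatio hI, ENNReal.toReal_one]

/-- Identifies the Radon-Nikodym form of the log-likelihood ratio, in which the divergence is
defined, with the explicit one; the sign changes because `logRatio` has `f 1` in the numerator. -/
lemma llr_law_ae_eq (hI : ∀ i, 0 < B.klInfo i ∧ B.klInfo i < ∞) :
    MeasureTheory.llr (B.law 0) (B.law 1) =ᵐ[B.law 0] fun x => -B.logRatio x := by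
  have h : (B.law 0).rnDeriv (B.law 1) =ᵐ[B.law 1]
      fun x => ENNReal.ofReal (Real.exp (-B.logRatio x)) := by
    have := Measure.rnDeriv_withDensity (B.law 1)
      (f := fun x => ENNReal.ofReal (Real.exp (-B.logRatio x))) (by fun_prop)
    rwa [← law_zero_eq hI] at this
  filter_upwards [(absolutelyContinuous_law hI).1.ae_le h] with x hx
  rw [MeasureTheory.llr, hx, ENNReal.toReal_ofReal (Real.exp_pos _).le, Real.log_exp]

lemma integrable_logRatio (hI : ∀ i, 0 < B.klInfo i ∧ B.klInfo i < ∞) :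
    Integrable B.logRatio (B.law 0) := by
  have := (InformationTheory.klDiv_ne_top_iff.1 (hI 0).2.ne).2
  simpa using ((integrable_congr (llr_law_ae_eq hI)).1 this).neg

lemma integral_logRatio (hI : ∀ i, 0 < B.klInfo i ∧ B.klInfo i < ∞) :
    ∫ x, B.logRatio x ∂(B.law 0) = -(B.klInfo 0).toReal := by
  have h : (B.klInfo 0).toReal = ∫ x, MeasureTheory.llr (B.law 0) (B.law 1) x ∂(B.law 0) :=
    InformationTheory.toReal_klDiv_of_measure_eq (absolutelyContinuous_law hI).1 (by simp)
  rw [h, integral_congr_ae (llr_law_ae_eq hI), integral_neg, neg_neg]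

lemma klInfo_toReal_pos (hI : ∀ i, 0 < B.klInfo i ∧ B.klInfo i < ∞) (i : Fin 2) :
    0 < (B.klInfo i).toReal := ENNReal.toReal_pos (hI i).1.ne' (hI i).2.ne

/-! ### Sequences of observations -/

variable (B) in
instance isProbabilityMeasure_P (i : Fin 2) : IsProbabilityMeasure (B.P i) := by
  rw [P]; infer_instance

variable (B) in
lemma llr_eq (n : ℕ) (ω : ℕ → 𝓧) : B.llr n ω = ∑ k ∈ Finset.range n, B.logRatio (ω k) := rfl

variable (B) in
lemma measurable_llr_past {n N : ℕ} (h : n ≤ N) : Measurable[past 𝓧 N] (B.llr n) := by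
  have : B.llr n = (fun x : Fin N → 𝓧 => ∑ k ∈ (Finset.univ.filter fun k : Fin N => (k : ℕ) < n),
      B.logRatio (x k)) ∘ (fun (ω : ℕ → 𝓧) (k : Fin N) => ω k) := by
    ext ω
    rw [llr_eq, Function.comp]
    refine Finset.sum_bij' (fun k hk => ⟨k, (Finset.mem_range.1 hk).trans_le h⟩)
      (fun k _ => (k : ℕ)) ?_ ?_ ?_ ?_ ?_ <;> simp
  rw [this]
  exact Measurable.comp (by fun_prop) (comap_measurable _)

variable (B) in
lemma measurable_avgLlr_past {n N : ℕ} (h : n ≤ N) : Measurable[past 𝓧 N] (B.avgLlr n) :=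
  (B.measurable_llr_past h).div_const _

lemma past_le (n : ℕ) : past 𝓧 n ≤ MeasurableSpace.pi := by
  rintro _ ⟨S, hS, rfl⟩
  exact (measurable_pi_lambda _ fun k => measurable_pi_apply _) hS

lemma past_mono {n N : ℕ} (h : n ≤ N) : past 𝓧 n ≤ past 𝓧 N := by
  rintro _ ⟨S, hS, rfl⟩
  refine ⟨(fun (x : Fin N → 𝓧) (k : Fin n) => x (Fin.castLE h k)) ⁻¹' S,
    (measurable_pi_lambda _ fun k => measurable_pi_apply _) hS, rfl⟩

variable (B) in
@[fun_prop]
lemma measurable_llr (n : ℕ) : Measurable (B.llr n) :=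
  (B.measurable_llr_past le_rfl).mono (past_le n) le_rfl

variable (B) in
@[fun_prop]
lemma measurable_avgLlr (n : ℕ) : Measurable (B.avgLlr n) := (B.measurable_llr n).div_const _

variable (B) in
lemma measurePreserving_eval (i : Fin 2) (k : ℕ) :
    MeasurePreserving (fun ω : ℕ → 𝓧 => ω k) (B.P i) (B.law i) :=
  measurePreserving_eval_infinitePi (fun _ : ℕ => B.law i) k

variable (B) in
lemma iIndepFun_eval (i : Fin 2) :
    ProbabilityTheory.iIndepFun (fun (k : ℕ) (ω : ℕ → 𝓧) => ω k) (B.P i) :=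
  ProbabilityTheory.iIndepFun_infinitePi (P := fun _ : ℕ => B.law i) (X := fun _ x => x)
    (fun _ => measurable_id)

variable (B) in
lemma mgf_llr (i : Fin 2) (n : ℕ) (t : ℝ) :
    ProbabilityTheory.mgf (B.llr n) (B.P i) t =
      ProbabilityTheory.mgf B.logRatio (B.law i) t ^ n := by
  have h := ((B.iIndepFun_eval i).comp (fun _ => B.logRatio) fun _ => B.measurable_logRatio).mgf_sum
    (t := t) (fun k => B.measurable_logRatio.comp (measurable_pi_apply k)) (Finset.range n)
  have h1 : B.llr n = ∑ k ∈ Finset.range n, (B.logRatio ∘ fun ω : ℕ → 𝓧 => ω k) := by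
    ext ω; simp [llr_eq]
  have h2 : ∀ k : ℕ, ProbabilityTheory.mgf (B.logRatio ∘ fun ω : ℕ → 𝓧 => ω k) (B.P i) t =
      ProbabilityTheory.mgf B.logRatio (B.law i) t := by
    intro k
    rw [← (B.measurePreserving_eval i k).map_eq, ProbabilityTheory.mgf_map
      (Y := fun ω : ℕ → 𝓧 => ω k) (measurable_pi_apply k).aemeasurable]
    exact AEMeasurable.aestronglyMeasurable (by fun_prop)
  rw [h1, h, Finset.prod_congr rfl fun k _ => h2 k]
  simp

variable (B) in
lemma integrable_exp_llr (i : Fin 2) (n : ℕ) {t : ℝ}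
    (h : Integrable (fun x => Real.exp (t * B.logRatio x)) (B.law i)) :
    Integrable (fun ω => Real.exp (t * B.llr n ω)) (B.P i) := by
  have := ProbabilityTheory.iIndepFun.integrable_exp_mul_sum (t := t) (s := Finset.range n)
    ((B.iIndepFun_eval i).comp (fun _ => B.logRatio) fun _ => B.measurable_logRatio)
    (fun k => B.measurable_logRatio.comp (measurable_pi_apply k))
    (fun k _ => (B.measurePreserving_eval i k).integrable_comp_of_integrable h)
  simpa [llr_eq] using this

/-- `J` and `κ` are exponential rates at which the tests `avgLlr n > -J` of fixed sample size `n`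
separate the two hypotheses. -/
def SeparatesAt (B : TestingProblem 𝓧) (J κ : ℝ) : Prop :=
  ∀ n : ℕ, (B.P 0).real {ω | -J < B.avgLlr n ω} ≤ Real.exp (-(κ * n)) ∧
    (B.P 1).real {ω | B.avgLlr n ω ≤ -J} ≤ Real.exp (-(J * n))

/-- The threshold `-J` exceeds the `P_0`-mean `-I_0` of `logRatio`, so a small exponential tilt
gives decay under `P_0`. Under `P_1` the tilt `-1` has moment generating function exactly `1`, which
gives the sharp rate `J`. -/
lemma exists_separatesAt (hI : ∀ i, 0 < B.klInfo i ∧ B.klInfo i < ∞) {J : ℝ}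
    (hJ : J < (B.klInfo 0).toReal) : ∃ κ > 0, B.SeparatesAt J κ := by
  -- The gap `c - J`, multiplied by the tilt `θ`, becomes the rate `κ`.
  obtain ⟨c, hc1, hc2⟩ := exists_between hJ
  obtain ⟨θ, hθ, -, hint, hmgf⟩ := exists_mgf_le_exp (integrable_logRatio hI)
    (integrable_exp_logRatio hI) (c := -c) (by rw [integral_logRatio hI]; linarith)
  refine ⟨θ * (c - J), mul_pos hθ (by linarith), fun n => ?_⟩
  rcases n.eq_zero_or_pos with rfl | hn
  · simp
  have hn' : (0 : ℝ) < n := by positivity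
  constructor
  · calc (B.P 0).real {ω | -J < B.avgLlr n ω} ≤ (B.P 0).real {ω | -J * n ≤ B.llr n ω} :=
          measureReal_mono fun ω hω => ((lt_div_iff₀ hn').1 hω).le
      _ ≤ Real.exp (-θ * (-J * n)) * ProbabilityTheory.mgf (B.llr n) (B.P 0) θ :=
          ProbabilityTheory.measure_ge_le_exp_mul_mgf _ hθ.le (B.integrable_exp_llr 0 n hint)
      _ ≤ Real.exp (-θ * (-J * n)) * Real.exp (θ * -c) ^ n := by
          rw [mgf_llr]
          gcongr
          exact ProbabilityTheory.mgf_nonneg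
      _ = Real.exp (-(θ * (c - J) * n)) := by
          rw [← Real.exp_nat_mul, ← Real.exp_add]; ring_nf
  · have hint1 : Integrable (fun x => Real.exp (-1 * B.logRatio x)) (B.law 1) := by
      simpa using integrable_exp_neg_logRatio hI
    calc (B.P 1).real {ω | B.avgLlr n ω ≤ -J} ≤ (B.P 1).real {ω | B.llr n ω ≤ -J * n} :=
          measureReal_mono fun ω hω => (div_le_iff₀ hn').1 hω
      _ ≤ Real.exp (-(-1) * (-J * n)) * ProbabilityTheory.mgf (B.llr n) (B.P 1) (-1) :=
          ProbabilityTheory.measure_le_le_exp_mul_mgf _ (by norm_num)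
            (B.integrable_exp_llr 1 n hint1)
      _ = Real.exp (-(J * n)) := by
          have : ProbabilityTheory.mgf B.logRatio (B.law 1) (-1) = 1 := by
            simpa [ProbabilityTheory.mgf] using integral_exp_neg_logRatio hI
          rw [mgf_llr, this]; simp

/-- Guarantees that the sets whose infima define the sample sizes are nonempty, so that these infima
are attained and not the default `0`. -/
lemma SeparatesAt.eventually_exists {J κ : ℝ} (h : B.SeparatesAt J κ) (hJ : 0 < J) (hκ : 0 < κ)
    {a b : ℝ} (ha : 0 < a) (hb : 0 < b) : ∀ᶠ n : ℕ in atTop, ∃ c : ℝ,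
      (B.P 0).real {ω | c < B.avgLlr n ω} ≤ a ∧ (B.P 1).real {ω | B.avgLlr n ω ≤ c} ≤ b := by
  have key : ∀ r : ℝ, 0 < r → Tendsto (fun n : ℕ => Real.exp (-(r * n))) atTop (𝓝 0) := by
    intro r hr
    exact Real.tendsto_exp_neg_atTop_nhds_zero.comp
      (tendsto_natCast_atTop_atTop.const_mul_atTop hr)
  filter_upwards [(key κ hκ).eventually (gt_mem_nhds ha), (key J hJ).eventually (gt_mem_nhds hb)]
    with n h0 h1
  exact ⟨-J, (h n).1.trans h0.le, (h n).2.trans h1.le⟩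

/-! ### The lower bound for the expected sample size -/

/-- A product measure is determined on rectangles, where the indicator times the product density
splits into one-dimensional factors. -/
lemma pi_law_one (hI : ∀ i, 0 < B.klInfo i ∧ B.klInfo i < ∞) (n : ℕ) :
    Measure.pi (fun _ : Fin n => B.law 1) = (Measure.pi (fun _ : Fin n => B.law 0)).withDensity
      (fun x => ∏ k, ENNReal.ofReal (Real.exp (B.logRatio (x k)))) := by
  refine Measure.pi_eq (μ := fun _ : Fin n => B.law 1) fun s hs => ?_
  rw [withDensity_apply _ (MeasurableSet.univ_pi hs), ← lintegral_indicator
    (MeasurableSet.univ_pi hs)]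
  have h1 : ∀ x : Fin n → 𝓧, (univ.pi s).indicator
      (fun x => ∏ k, ENNReal.ofReal (Real.exp (B.logRatio (x k)))) x =
      ∏ k, (s k).indicator (fun y => ENNReal.ofReal (Real.exp (B.logRatio y))) (x k) := by
    intro x
    by_cases hx : x ∈ univ.pi s
    · rw [indicator_of_mem hx]
      exact Finset.prod_congr rfl fun k _ => (indicator_of_mem (hx k (mem_univ k))
        fun y => ENNReal.ofReal (Real.exp (B.logRatio y))).symm
    · rw [indicator_of_notMem hx]
      obtain ⟨k, hk⟩ : ∃ k, x k ∉ s k := by simpa using hx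
      exact (Finset.prod_eq_zero (Finset.mem_univ k) (indicator_of_notMem hk _)).symm
  have hm : ∀ k, Measurable ((s k).indicator
      fun y => ENNReal.ofReal (Real.exp (B.logRatio y))) := fun k =>
    Measurable.indicator (by fun_prop) (hs k)
  simp_rw [h1]
  rw [ProbabilityTheory.lintegral_prod_eq_prod_lintegral_of_indepFun Finset.univ
    (fun k (x : Fin n → 𝓧) => (s k).indicator
      (fun y => ENNReal.ofReal (Real.exp (B.logRatio y))) (x k))
    (ProbabilityTheory.iIndepFun_pi (μ := fun _ : Fin n => B.law 0) fun k => (hm k).aemeasurable)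
    fun k => (hm k).comp (measurable_pi_apply k)]
  refine Finset.prod_congr rfl fun k _ => ?_
  rw [(MeasureTheory.measurePreserving_eval (fun _ : Fin n => B.law 0) k).lintegral_comp (hm k),
    lintegral_indicator (hs k), ← withDensity_apply _ (hs k), ← law_one_eq hI]

variable (B) in
lemma P_preimage (i : Fin 2) {n : ℕ} {S : Set (Fin n → 𝓧)} (hS : MeasurableSet S) :
    B.P i ((fun (ω : ℕ → 𝓧) (k : Fin n) => ω k) ⁻¹' S) = Measure.pi (fun _ => B.law i) S := by
  have h : (B.P i).map (fun (ω : ℕ → 𝓧) (k : Fin n) => ω k) = Measure.pi fun _ => B.law i := by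
    rw [← Measure.infinitePi_eq_pi]
    exact Measure.map_infinitePi_infinitePi_of_inj
      (Fin.val_injective (n := n)) (P := fun _ : ℕ => B.law i)
  rw [← h, Measure.map_apply (by fun_prop) hS]

/-- Change of measure on the first `n` observations. -/
lemma measureReal_inter_le (hI : ∀ i, 0 < B.klInfo i ∧ B.klInfo i < ∞) {n : ℕ} (c : ℝ)
    {A : Set (ℕ → 𝓧)} (hA : MeasurableSet[past 𝓧 n] A) :
    (B.P 0).real (A ∩ {ω | -c ≤ B.llr n ω}) ≤ Real.exp c * (B.P 1).real A := by
  have hC : MeasurableSet[past 𝓧 n] (A ∩ {ω | -c ≤ B.llr n ω}) :=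
    hA.inter (measurableSet_le measurable_const (B.measurable_llr_past le_rfl))
  -- On the event the likelihood ratio `exp (Λ_n)` is at least `exp (-c)`, so integrating it against
  -- `P_0` gives the claim.
  suffices h : ENNReal.ofReal (Real.exp (-c)) * B.P 0 (A ∩ {ω | -c ≤ B.llr n ω}) ≤ B.P 1 A by
    have h' := ENNReal.toReal_mono (measure_ne_top _ _) h
    rw [ENNReal.toReal_mul, ENNReal.toReal_ofReal (Real.exp_pos _).le] at h'
    calc _ = Real.exp c * (Real.exp (-c) * (B.P 0).real (A ∩ {ω | -c ≤ B.llr n ω})) := by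
          rw [← mul_assoc, ← Real.exp_add]; simp
      _ ≤ _ := mul_le_mul_of_nonneg_left h' (Real.exp_pos c).le
  refine le_trans ?_ (measure_mono (inter_subset_left (t := {ω | -c ≤ B.llr n ω})))
  obtain ⟨S, hS, hSA⟩ := hC
  rw [← hSA, B.P_preimage 0 hS, B.P_preimage 1 hS, pi_law_one hI, withDensity_apply _ hS,
    ← setLIntegral_const]
  refine setLIntegral_mono' hS fun x hx => ?_
  -- The finite vector is extended arbitrarily to a sequence, so that the product density can be
  -- read as `exp (llr n ω)`.
  have : Nonempty 𝓧 := nonempty_of_isProbabilityMeasure (B.law 0)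
  obtain ⟨ω, rfl⟩ : ∃ ω : ℕ → 𝓧, (fun k : Fin n => ω k) = x :=
    ⟨fun k => if h : k < n then x ⟨k, h⟩ else Classical.arbitrary 𝓧, by ext k; simp⟩
  have hω : -c ≤ B.llr n ω := by
    have : ω ∈ A ∩ {ω | -c ≤ B.llr n ω} := by rw [← hSA]; exact hx
    exact this.2
  rw [← ENNReal.ofReal_prod_of_nonneg fun k _ => (Real.exp_pos _).le, ← Real.exp_sum,
    Fin.sum_univ_eq_sum_range (fun k => B.logRatio (ω k)), ← llr_eq]
  gcongr

lemma tendsto_measureReal_llr_lt (hI : ∀ i, 0 < B.klInfo i ∧ B.klInfo i < ∞) {J : ℝ}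
    (hJ : (B.klInfo 0).toReal < J) :
    Tendsto (fun n : ℕ => (B.P 0).real {ω | B.llr n ω < -(J * n)}) atTop (𝓝 0) := by
  have hslln : ∀ᵐ ω ∂(B.P 0), Tendsto (fun n : ℕ => B.avgLlr n ω) atTop
      (𝓝 (-(B.klInfo 0).toReal)) := by
    have hid : ∀ k : ℕ, ProbabilityTheory.IdentDistrib (fun ω : ℕ → 𝓧 => B.logRatio (ω k))
        (fun ω => B.logRatio (ω 0)) (B.P 0) (B.P 0) := by
      intro k
      refine ProbabilityTheory.IdentDistrib.comp (u := B.logRatio) ⟨(measurable_pi_apply k).aemeasurable,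
        (measurable_pi_apply 0).aemeasurable, ?_⟩
        B.measurable_logRatio
      rw [(B.measurePreserving_eval 0 k).map_eq, (B.measurePreserving_eval 0 0).map_eq]
    have h := ProbabilityTheory.strong_law_ae_real (μ := B.P 0)
      (fun (k : ℕ) (ω : ℕ → 𝓧) => B.logRatio (ω k))
      ((B.measurePreserving_eval 0 0).integrable_comp_of_integrable (integrable_logRatio hI))
      (fun j k hjk => ((B.iIndepFun_eval 0).indepFun hjk).comp B.measurable_logRatio
        B.measurable_logRatio) hid
    have h2 : ∫ ω, B.logRatio (ω 0) ∂(B.P 0) = -(B.klInfo 0).toReal := by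
      rw [← integral_logRatio hI, ← (B.measurePreserving_eval 0 0).map_eq, integral_map
        (measurable_pi_apply 0).aemeasurable (by fun_prop)]
    simp only [h2] at h
    exact h
  -- An average below `-J` is at distance at least `J - I_0` from its limit `-I_0`.
  have h := tendstoInMeasure_of_tendsto_ae (fun n => (B.measurable_avgLlr n).aestronglyMeasurable)
    hslln (ENNReal.ofReal (J - (B.klInfo 0).toReal)) (by simpa using hJ)
  have h' := (ENNReal.tendsto_toReal ENNReal.zero_ne_top).comp h
  refine squeeze_zero' (Eventually.of_forall fun n => measureReal_nonneg) ?_ h'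
  filter_upwards [eventually_gt_atTop 0] with n hn
  refine measureReal_mono fun ω hω => ?_
  have hn' : (0 : ℝ) < n := by positivity
  have h3 : B.avgLlr n ω < -J := by
    rw [avgLlr, div_lt_iff₀ hn', neg_mul]; exact hω
  rw [mem_ofPred_eq, edist_dist, Real.dist_eq]
  refine ENNReal.ofReal_le_ofReal ?_
  rw [abs_of_nonpos] <;> linarith

lemma measurableSet_le_inter {τ : TimeDecision 𝓧} (hτ : B.IsTest τ) (n : ℕ) (i : Fin 2) :
    MeasurableSet[past 𝓧 n] {ω | τ.1 ω ≤ n ∧ τ.2 ω = i} := by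
  have : {ω | τ.1 ω ≤ n ∧ τ.2 ω = i} = ⋃ k ∈ Finset.Icc 1 n, {ω | τ.1 ω = k ∧ τ.2 ω = i} := by
    ext ω
    simp only [mem_ofPred_eq, mem_iUnion, Finset.mem_Icc, exists_prop]
    constructor
    · rintro ⟨h1, h2⟩
      lift τ.1 ω to ℕ using (h1.trans_lt (ENat.natCast_lt_top n)).ne with k hk
      have := hτ.one_le ω
      rw [← hk] at this
      exact ⟨k, ⟨by exact_mod_cast this, by exact_mod_cast h1⟩, rfl, h2⟩
    · rintro ⟨k, ⟨-, h1⟩, h2, h3⟩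
      exact ⟨by rw [h2]; exact_mod_cast h1, h3⟩
  rw [this]
  refine MeasurableSet.biUnion (Finset.countable_toSet _) fun k hk => ?_
  have hk := Finset.mem_Icc.1 hk
  exact past_mono hk.2 _ (hτ.adapted_decision k hk.1 i)

/-- If `T ≤ n`, then the test rejects, or it accepts with `Λ_n ≥ -c`, or `Λ_n < -c`. The first two
cases cost at most `a` and `exp c * b`, the second by change of measure. Markov's inequality then
bounds the `P_0` part, and the `P_1` part is dropped. -/
lemma le_ess_of_mem_testClass (hI : ∀ i, 0 < B.klInfo i ∧ B.klInfo i < ∞) {a b p : ℝ}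
    (c : ℝ) (n : ℕ) {τ : TimeDecision 𝓧} (hτ : τ ∈ B.testClass a b) (hp : p ≤ 1) :
    ENNReal.ofReal ((1 - p) * (n * (1 - a - Real.exp c * b -
      (B.P 0).real {ω | B.llr n ω < -c}))) ≤ B.ess p τ.1 := by
  obtain ⟨hτ, h0, h1⟩ := hτ
  have hset : MeasurableSet {ω | τ.1 ω ≤ n} := by
    have : {ω | τ.1 ω ≤ n} = {ω | τ.1 ω ≤ n ∧ τ.2 ω = 0} ∪ {ω | τ.1 ω ≤ n ∧ τ.2 ω = 1} := by
      ext ω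
      have : τ.2 ω = 0 ∨ τ.2 ω = 1 := by omega
      simp only [mem_ofPred_eq, mem_union]
      tauto
    rw [this]
    exact past_le n _ ((measurableSet_le_inter hτ n 0).union (measurableSet_le_inter hτ n 1))
  have hle : (B.P 0).real {ω | τ.1 ω ≤ n} ≤
      a + Real.exp c * b + (B.P 0).real {ω | B.llr n ω < -c} := by
    have hsub : {ω | τ.1 ω ≤ n} ⊆ ({ω | τ.2 ω = 1} ∪
        ({ω | τ.1 ω ≤ n ∧ τ.2 ω = 0} ∩ {ω | -c ≤ B.llr n ω})) ∪ {ω | B.llr n ω < -c} := by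
      intro ω hω
      have : τ.2 ω = 0 ∨ τ.2 ω = 1 := by omega
      have := le_or_gt (-c) (B.llr n ω)
      simp only [mem_ofPred_eq, mem_union, mem_inter_iff] at hω ⊢
      tauto
    refine (measureReal_mono hsub).trans ((measureReal_union_le _ _).trans ?_)
    gcongr
    refine (measureReal_union_le _ _).trans ?_
    gcongr
    refine (measureReal_inter_le hI c (measurableSet_le_inter hτ n 0)).trans ?_
    gcongr
    exact (measureReal_mono fun ω hω => hω.2).trans h1
  have hgt : 1 - a - Real.exp c * b - (B.P 0).real {ω | B.llr n ω < -c} ≤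
      (B.P 0).real {ω | τ.1 ω ≤ n}ᶜ := by
    rw [probReal_compl_eq_one_sub hset]; linarith
  rw [ess, mix, lintegral_add_measure, lintegral_smul_measure]
  refine le_add_right ?_
  rw [smul_eq_mul, ENNReal.ofReal_mul (by linarith)]
  gcongr
  calc ENNReal.ofReal _ ≤ ENNReal.ofReal (n * (B.P 0).real {ω | τ.1 ω ≤ n}ᶜ) := by gcongr
    _ = ∫⁻ ω in {ω | τ.1 ω ≤ n}ᶜ, n ∂(B.P 0) := by
        rw [setLIntegral_const, ENNReal.ofReal_mul (by positivity), ENNReal.ofReal_natCast,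
          ofReal_measureReal]
    _ ≤ ∫⁻ ω in {ω | τ.1 ω ≤ n}ᶜ, (τ.1 ω : ℝ≥0∞) ∂(B.P 0) := by
        refine setLIntegral_mono' hset.compl fun ω hω => ?_
        have : (n : ℕ∞) ≤ τ.1 ω := (not_le.1 (show ¬ τ.1 ω ≤ n from hω)).le
        exact_mod_cast ENat.toENNReal_mono this
    _ ≤ _ := setLIntegral_le_lintegral _ _

lemma le_optEss (hI : ∀ i, 0 < B.klInfo i ∧ B.klInfo i < ∞) {p : ℝ} (a b c : ℝ) (n : ℕ)
    (hp : p ≤ 1) :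
    ENNReal.ofReal ((1 - p) * (n * (1 - a - Real.exp c * b -
      (B.P 0).real {ω | B.llr n ω < -c}))) ≤ B.optEss p a b :=
  le_iInf₂ fun _ hτ => le_ess_of_mem_testClass hI c n hτ hp

lemma optEss_le {p a b : ℝ} {τ : TimeDecision 𝓧} (hτ : τ ∈ B.testClass a b) :
    B.optEss p a b ≤ B.ess p τ.1 := iInf₂_le τ hτ

/-! ### Least thresholds -/

/-- Along thresholds decreasing to the infimum the upper-tail events increase to that of the
infimum, so continuity from below keeps the first constraint; the second is monotone in the
threshold. Extended reals allow the infimum `-∞`. -/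
lemma sInf_threshold_mem {Ω : Type*} {mΩ : MeasurableSpace Ω} {μ μ' : Measure Ω}
    [IsFiniteMeasure μ] [IsFiniteMeasure μ'] (X : Ω → ℝ) (A : Set Ω) {a b : ℝ} {C : Set EReal}
    (hC : C = {c : EReal | μ.real ({ω | c < (X ω : EReal)} ∩ A) ≤ a ∧
      μ'.real {ω | (X ω : EReal) ≤ c} ≤ b}) (hne : C.Nonempty) : sInf C ∈ C := by
  obtain ⟨v, hv, hlim, hmem⟩ := exists_seq_tendsto_sInf hne (OrderBot.bddBelow C)
  have hmem' : ∀ n, μ.real ({ω | v n < (X ω : EReal)} ∩ A) ≤ a ∧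
      μ'.real {ω | (X ω : EReal) ≤ v n} ≤ b := fun n => by have := hmem n; rwa [hC] at this
  have hle : ∀ n, sInf C ≤ v n := fun n => sInf_le (hmem n)
  rw [hC, mem_ofPred_eq, ← hC]
  constructor
  · have hU : {ω | sInf C < (X ω : EReal)} ∩ A = ⋃ n, {ω | v n < (X ω : EReal)} ∩ A := by
      rw [← iUnion_inter]
      congr 1
      ext ω
      simp only [mem_ofPred_eq, mem_iUnion]
      exact ⟨fun h => (hlim.eventually (gt_mem_nhds h)).exists,
        fun ⟨n, hn⟩ => (hle n).trans_lt hn⟩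
    have hmono : Monotone fun n => {ω | v n < (X ω : EReal)} ∩ A := fun m n hmn =>
      inter_subset_inter_left _ fun ω hω => (hv hmn).trans_lt hω
    rw [hU]
    exact le_of_tendsto' ((ENNReal.tendsto_toReal (measure_ne_top _ _)).comp
      (tendsto_measure_iUnion_atTop hmono)) fun n => (hmem' n).1
  · exact (measureReal_mono fun ω hω => le_trans hω (hle 0)).trans (hmem' 0).2

/-! ### The fixed-sample-size test -/

variable {J κ : ℝ}

lemma SeparatesAt.fssSize_spec (h : B.SeparatesAt J κ) (hJ : 0 < J) (hκ : 0 < κ)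
    {a b : ℝ} (ha : 0 < a) (hb : 0 < b) : 1 ≤ B.fssSize a b ∧
      (B.P 0).real {ω | B.fssThr a b < (B.avgLlr (B.fssSize a b) ω : EReal)} ≤ a ∧
      (B.P 1).real {ω | (B.avgLlr (B.fssSize a b) ω : EReal) ≤ B.fssThr a b} ≤ b := by
  obtain ⟨n, h1, h2⟩ := ((eventually_ge_atTop 1).and (h.eventually_exists hJ hκ ha hb)).exists
  obtain ⟨h3, c, h4⟩ := Nat.sInf_mem (s := {n : ℕ | 1 ≤ n ∧ ∃ c : ℝ,
    (B.P 0).real {ω | c < B.avgLlr n ω} ≤ a ∧ (B.P 1).real {ω | B.avgLlr n ω ≤ c} ≤ b})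
    ⟨n, h1, h2⟩
  refine ⟨h3, ?_⟩
  have hne : {c : EReal | (B.P 0).real {ω | c < (B.avgLlr (B.fssSize a b) ω : EReal)} ≤ a ∧
      (B.P 1).real {ω | (B.avgLlr (B.fssSize a b) ω : EReal) ≤ c} ≤ b}.Nonempty :=
    ⟨(c : EReal), by
      simp only [mem_ofPred_eq, EReal.coe_lt_coe_iff, EReal.coe_le_coe_iff]
      exact h4⟩
  exact sInf_threshold_mem (μ := B.P 0) (μ' := B.P 1) (a := a) (b := b)
    (B.avgLlr (B.fssSize a b)) univ (by simp only [inter_univ]) hne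

lemma SeparatesAt.fssSize_le (h : B.SeparatesAt J κ) {a b : ℝ} {n : ℕ} (hn : 1 ≤ n)
    (ha : Real.exp (-(κ * n)) ≤ a) (hb : Real.exp (-(J * n)) ≤ b) : B.fssSize a b ≤ n :=
  Nat.sInf_le ⟨hn, -J, (h n).1.trans ha, (h n).2.trans hb⟩

/-! ### Tests that compare a statistic with a threshold after each stage -/

/-- The event that the null hypothesis is not accepted in the first `j` stages. -/
def passSet (b : ℕ → EReal) (S : ℕ → (ℕ → 𝓧) → ℝ) (j : ℕ) : Set (ℕ → 𝓧) :=
  {ω | ∀ i ∈ Finset.Icc 1 j, b i < (S i ω : EReal)}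

/-- The last stage of the test `thresholding`. -/
noncomputable def lastStage (K : ℕ) (b : ℕ → EReal) (S : ℕ → (ℕ → 𝓧) → ℝ) (ω : ℕ → 𝓧) : ℕ :=
  sInf {j : ℕ | 1 ≤ j ∧ (j = K ∨ (S j ω : EReal) ≤ b j)}

section thresholding

variable {K : ℕ} {M : ℕ → ℕ} {b : ℕ → EReal} {S : ℕ → (ℕ → 𝓧) → ℝ}

lemma thresholding_fst (ω : ℕ → 𝓧) :
    (thresholding K M b S).1 ω = (M (lastStage K b S ω) : ℕ∞) := rfl

lemma thresholding_snd_eq_one_iff (ω : ℕ → 𝓧) :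
    (thresholding K M b S).2 ω = 1 ↔ ω ∈ passSet b S K := by
  simp only [thresholding, passSet, mem_ofPred_eq]
  split_ifs with h
  · exact ⟨fun _ => h, fun _ => rfl⟩
  · exact ⟨fun h' => absurd h' (by decide), fun h' => absurd h' h⟩

lemma thresholding_snd_eq_zero_iff (ω : ℕ → 𝓧) :
    (thresholding K M b S).2 ω = 0 ↔ ω ∉ passSet b S K := by
  simp only [thresholding, passSet, mem_ofPred_eq]
  split_ifs with h
  · exact ⟨fun h' => absurd h' (by decide), fun h' => absurd h h'⟩
  · exact ⟨fun _ => h, fun _ => rfl⟩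

/-- Stage `K` always qualifies, so the infimum is attained; minimality says that all earlier stages
were passed. -/
lemma lastStage_eq_iff (hK : 1 ≤ K) {j : ℕ} (ω : ℕ → 𝓧) : lastStage K b S ω = j ↔
    1 ≤ j ∧ j ≤ K ∧ ω ∈ passSet b S (j - 1) ∧ (j = K ∨ (S j ω : EReal) ≤ b j) := by
  have hmem := Nat.sInf_mem (s := {j : ℕ | 1 ≤ j ∧ (j = K ∨ (S j ω : EReal) ≤ b j)})
    ⟨K, hK, Or.inl rfl⟩
  have hmin : ∀ i, 1 ≤ i → (i = K ∨ (S i ω : EReal) ≤ b i) → lastStage K b S ω ≤ i :=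
    fun i h1 h2 => Nat.sInf_le ⟨h1, h2⟩
  change 1 ≤ lastStage K b S ω ∧ (lastStage K b S ω = K ∨ _) at hmem
  constructor
  · rintro rfl
    refine ⟨hmem.1, hmin K hK (Or.inl rfl), fun i hi => ?_, hmem.2⟩
    rw [Finset.mem_Icc] at hi
    by_contra hcon
    have := hmin i hi.1 (Or.inr (not_lt.1 hcon))
    omega
  · rintro ⟨h1, h2, h3, h4⟩
    refine le_antisymm (hmin j h1 h4) ?_
    by_contra hcon
    rw [not_le] at hcon
    have h5 := h3 (lastStage K b S ω) (Finset.mem_Icc.2 ⟨hmem.1, by omega⟩)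
    rcases hmem.2 with h6 | h6
    · omega
    · exact absurd h6 (not_le.2 h5)

lemma measurableSet_passSet (hM : Monotone M)
    (hS : ∀ j, 1 ≤ j → Measurable[past 𝓧 (M j)] (S j)) {j N : ℕ} (h : M j ≤ N) :
    MeasurableSet[past 𝓧 N] (passSet b S j) := by
  have : passSet b S j = ⋂ i ∈ Finset.Icc 1 j, {ω | b i < (S i ω : EReal)} := by
    ext ω; simp [passSet]
  rw [this]
  refine MeasurableSet.biInter (Finset.countable_toSet _) fun i hi => ?_
  rw [Finset.mem_coe, Finset.mem_Icc] at hi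
  refine past_mono ((hM hi.2).trans h) _ ?_
  exact (measurable_coe_real_ereal.comp (hS i hi.1)) measurableSet_Ioi

lemma passSet_inter (j : ℕ) :
    passSet b S (j + 1) = passSet b S j ∩ {ω | b (j + 1) < (S (j + 1) ω : EReal)} := by
  ext ω
  constructor
  · intro h
    exact ⟨fun i hi => h i (Finset.Icc_subset_Icc_right (by omega) hi),
      h _ (Finset.mem_Icc.2 ⟨by omega, le_rfl⟩)⟩
  · rintro ⟨h1, h2⟩ i hi
    rw [Finset.mem_Icc] at hi
    rcases hi.2.lt_or_eq with h | rfl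
    · exact h1 i (Finset.mem_Icc.2 ⟨hi.1, by omega⟩)
    · exact h2

lemma passSet_zero : passSet b S 0 = univ := by ext ω; simp [passSet]

variable (B) in
lemma isTest_thresholding (hK : 1 ≤ K) (hM1 : 1 ≤ M 1) (hM : Monotone M)
    (hS : ∀ j, 1 ≤ j → Measurable[past 𝓧 (M j)] (S j)) :
    B.IsTest (thresholding K M b S) := by
  have hdec : ∀ n : ℕ, ∀ i : Fin 2, MeasurableSet[past 𝓧 n]
      {ω | (thresholding K M b S).1 ω = n ∧ (thresholding K M b S).2 ω = i} := by
    intro n i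
    -- Stages of mod-ST may be empty, so several `j` can share the total `n`; all of them enter the
    -- union.
    have hset : {ω | (thresholding K M b S).1 ω = n ∧ (thresholding K M b S).2 ω = i} =
        ⋃ j ∈ (Finset.Icc 1 K).filter fun j => M j = n,
          {ω | lastStage K b S ω = j ∧ (thresholding K M b S).2 ω = i} := by
      ext ω
      have := (lastStage_eq_iff (b := b) (S := S) hK ω).1 rfl
      simp only [mem_ofPred_eq, mem_iUnion, Finset.mem_filter, Finset.mem_Icc, exists_prop,
        thresholding_fst, Nat.cast_inj]
      constructor
      · rintro ⟨h1, h2⟩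
        exact ⟨_, ⟨⟨this.1, this.2.1⟩, h1⟩, rfl, h2⟩
      · rintro ⟨j, ⟨-, h1⟩, rfl, h2⟩
        exact ⟨h1, h2⟩
    rw [hset]
    refine MeasurableSet.biUnion (Finset.countable_toSet _) fun j hj => ?_
    obtain ⟨hj1, hj2⟩ := Finset.mem_filter.1 hj
    rw [Finset.mem_Icc] at hj1
    have hpass : ∀ k, k ≤ j → MeasurableSet[past 𝓧 n] (passSet b S k) := fun k hk =>
      measurableSet_passSet hM hS ((hM hk).trans hj2.le)
    have hSj : MeasurableSet[past 𝓧 n] {ω | (S j ω : EReal) ≤ b j} := by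
      rw [← hj2]
      exact (measurable_coe_real_ereal.comp (hS j hj1.1)) measurableSet_Iic
    have hi : i = 0 ∨ i = 1 := by omega
    obtain ⟨k, rfl⟩ : ∃ k, j = k + 1 := ⟨j - 1, by omega⟩
    rcases hi with rfl | rfl
    · have : {ω | lastStage K b S ω = k + 1 ∧ (thresholding K M b S).2 ω = 0} =
          passSet b S k ∩ {ω | (S (k + 1) ω : EReal) ≤ b (k + 1)} := by
        ext ω
        simp only [mem_ofPred_eq, lastStage_eq_iff hK, thresholding_snd_eq_zero_iff, mem_inter_iff,
          Nat.add_sub_cancel]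
        constructor
        · rintro ⟨⟨-, -, h1, h2 | h2⟩, h3⟩
          · refine ⟨h1, ?_⟩
            rw [← h2, passSet_inter] at h3
            by_contra hcon
            exact h3 ⟨h1, not_le.1 hcon⟩
          · exact ⟨h1, h2⟩
        · rintro ⟨h1, h2⟩
          exact ⟨⟨hj1.1, hj1.2, h1, Or.inr h2⟩, fun h =>
            absurd h2 (not_le.2 (h (k + 1) (Finset.mem_Icc.2 hj1)))⟩
      rw [this]
      exact (hpass k (by omega)).inter hSj
    -- Rejection is possible only at the last stage; an earlier stop means that a threshold was not
    -- exceeded.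
    · by_cases hjK : k + 1 = K
      · have : {ω | lastStage K b S ω = k + 1 ∧ (thresholding K M b S).2 ω = 1} =
            passSet b S (k + 1) := by
          ext ω
          rw [mem_ofPred_eq, lastStage_eq_iff hK, thresholding_snd_eq_one_iff, ← hjK]
          refine ⟨fun h => h.2, fun h => ⟨⟨hj1.1, le_rfl, ?_, Or.inl rfl⟩, h⟩⟩
          rw [passSet_inter] at h
          exact h.1
        rw [this]
        exact hpass _ le_rfl
      · have : {ω | lastStage K b S ω = k + 1 ∧ (thresholding K M b S).2 ω = 1} = ∅ := by
          ext ω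
          simp only [mem_ofPred_eq, lastStage_eq_iff hK, thresholding_snd_eq_one_iff,
            mem_empty_iff_false, iff_false, hjK, false_or]
          rintro ⟨⟨-, -, -, h2⟩, h3⟩
          exact absurd h2 (not_le.2 (h3 (k + 1) (Finset.mem_Icc.2 hj1)))
        rw [this]
        exact @MeasurableSet.empty _ (past 𝓧 n)
  refine ⟨fun ω => ?_, fun i => ae_of_all _ fun ω => ?_, ?_, fun n _ => ?_, fun n _ i => hdec n i⟩
  · rw [thresholding_fst]
    have := (lastStage_eq_iff (b := b) (S := S) hK ω).1 rfl
    exact_mod_cast hM1.trans (hM this.1)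
  · rw [thresholding_fst]
    exact ENat.natCast_ne_top _
  · have hpass : MeasurableSet (passSet b S K) :=
      past_le _ _ (measurableSet_passSet hM hS (le_refl (M K)))
    refine measurable_to_countable' fun i => ?_
    have hi : i = 0 ∨ i = 1 := by omega
    rcases hi with rfl | rfl
    · convert hpass.compl using 1
      ext ω
      exact thresholding_snd_eq_zero_iff ω
    · convert hpass using 1
      ext ω
      exact thresholding_snd_eq_one_iff ω
  · convert (hdec n 0).union (hdec n 1) using 1
    ext ω
    have : (thresholding K M b S).2 ω = 0 ∨ (thresholding K M b S).2 ω = 1 := by omega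
    simp only [mem_ofPred_eq, mem_union]
    tauto

variable (B) in
-- Rejection is exactly the event of passing all stages, and wrong acceptance is covered by a union
-- bound over stages, with no conditioning on the earlier ones.
lemma thresholding_mem_testClass (hK : 1 ≤ K) (hM1 : 1 ≤ M 1) (hM : Monotone M)
    (hS : ∀ j, 1 ≤ j → Measurable[past 𝓧 (M j)] (S j)) {α β : ℝ}
    (hα : (B.P 0).real (passSet b S K) ≤ α)
    (hβ : ∑ j ∈ Finset.Icc 1 K, (B.P 1).real {ω | (S j ω : EReal) ≤ b j} ≤ β) :
    thresholding K M b S ∈ B.testClass α β := by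
  refine ⟨B.isTest_thresholding hK hM1 hM hS, ?_, ?_⟩
  · convert hα using 2
    ext ω
    exact thresholding_snd_eq_one_iff ω
  · have : {ω | (thresholding K M b S).2 ω = 0} =
        ⋃ j ∈ Finset.Icc 1 K, {ω | (S j ω : EReal) ≤ b j} := by
      ext ω
      rw [mem_ofPred_eq, thresholding_snd_eq_zero_iff]
      simp [passSet, and_assoc]
    rw [this]
    exact (measureReal_biUnion_finset_le _ _).trans hβ

lemma thresholding_fst_le (hK : 1 ≤ K) (hM : Monotone M) (ω : ℕ → 𝓧) :
    ((thresholding K M b S).1 ω : ℝ≥0∞) ≤ (M K : ℝ≥0∞) := by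
  rw [thresholding_fst]
  have := (lastStage_eq_iff (b := b) (S := S) hK ω).1 rfl
  simpa using hM this.2.1

/-- Adding whole totals `M j` instead of increments overcounts, but the geometric decay of the
probabilities of reaching stage `j` makes this harmless. -/
lemma thresholding_fst_le_sum (hK : 1 ≤ K) (ω : ℕ → 𝓧) :
    ((thresholding K M b S).1 ω : ℝ≥0∞) ≤ (M 1 : ℝ≥0∞) +
      ∑ j ∈ Finset.Icc 2 K, (passSet b S (j - 1)).indicator (fun _ => (M j : ℝ≥0∞)) ω := by
  rw [thresholding_fst]
  have := (lastStage_eq_iff (b := b) (S := S) hK ω).1 rfl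
  set j := lastStage K b S ω
  rcases this.1.eq_or_lt with h | h
  · rw [← h]; simp
  · refine le_add_left ?_
    refine le_trans ?_ (Finset.single_le_sum (fun _ _ => zero_le)
      (Finset.mem_Icc.2 ⟨h, this.2.1⟩))
    rw [indicator_of_mem this.2.2.1]
    simp

variable (B) in
lemma ess_thresholding_le (hK : 1 ≤ K) (hM : Monotone M)
    (hS : ∀ j, 1 ≤ j → Measurable[past 𝓧 (M j)] (S j)) {p : ℝ} (hp : p ∈ Icc (0 : ℝ) 1) :
    B.ess p (thresholding K M b S).1 ≤ ENNReal.ofReal (M 1 +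
      ∑ j ∈ Finset.Icc 2 K, M j * (B.P 0).real (passSet b S (j - 1)) + p * M K) := by
  have h0 : ∫⁻ ω, ((thresholding K M b S).1 ω : ℝ≥0∞) ∂(B.P 0) ≤ ENNReal.ofReal (M 1 +
      ∑ j ∈ Finset.Icc 2 K, M j * (B.P 0).real (passSet b S (j - 1))) := by
    have hpass : ∀ j, MeasurableSet (passSet b S j) := fun j =>
      past_le _ _ (measurableSet_passSet hM hS (le_refl (M j)))
    refine (lintegral_mono (thresholding_fst_le_sum hK)).trans ?_
    rw [lintegral_add_left measurable_const, lintegral_finsetSum _ fun j _ =>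
      measurable_const.indicator (hpass _), ENNReal.ofReal_add (by positivity) (by positivity),
      ENNReal.ofReal_sum_of_nonneg fun j _ => by positivity]
    simp only [lintegral_const, measure_univ, mul_one, ENNReal.ofReal_natCast]
    gcongr with j
    rw [lintegral_indicator_const (hpass _), ENNReal.ofReal_mul (by positivity),
      ENNReal.ofReal_natCast, ofReal_measureReal]
  have h1 : ∫⁻ ω, ((thresholding K M b S).1 ω : ℝ≥0∞) ∂(B.P 1) ≤ M K :=
    (lintegral_mono (thresholding_fst_le hK hM)).trans (by simp)
  rw [ess, mix, lintegral_add_measure, lintegral_smul_measure, lintegral_smul_measure,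
    ENNReal.ofReal_add (by positivity) (mul_nonneg hp.1 (by positivity)), smul_eq_mul, smul_eq_mul,
    ENNReal.ofReal_mul hp.1, ENNReal.ofReal_natCast]
  gcongr
  refine le_trans ?_ h0
  refine (mul_le_mul_left (ENNReal.ofReal_le_one.2 (by linarith [hp.1])) _).trans ?_
  rw [one_mul]

/-- `∑ j² a ^ (j - 1)` over `2 ≤ j ≤ K` is `O(a)`. -/
lemma sum_sq_mul_pow_le {a : ℝ} (h0 : 0 ≤ a) (h1 : a ≤ 1 / 8) (K : ℕ) :
    ∑ j ∈ Finset.Icc 2 K, (j : ℝ) ^ 2 * a ^ (j - 1) ≤ 8 * a := by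
  -- The factor `1 - (1 / 2) ^ k` strengthens the induction: since `j ≤ 2 ^ (j - 1)` and `a ≤ 1 /
  -- 8`, the terms are dominated by a geometric series of ratio `1 / 2`.
  have key : ∀ k : ℕ, ∑ j ∈ Finset.Icc 2 (k + 1), (j : ℝ) ^ 2 * a ^ (j - 1) ≤
      8 * a * (1 - (1 / 2) ^ k) := by
    intro k
    induction k with
    | zero => simp
    | succ k ih =>
      rw [Finset.sum_Icc_succ_top (by omega)]
      have h4 : ((k + 2 : ℕ) : ℝ) ^ 2 ≤ 4 ^ (k + 1) := by
        have : ((k + 2 : ℕ) : ℝ) ≤ 2 ^ (k + 1) := by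
          exact_mod_cast Nat.lt_two_pow_self (n := k + 1)
        calc ((k + 2 : ℕ) : ℝ) ^ 2 ≤ (2 ^ (k + 1)) ^ 2 := by gcongr
          _ = 4 ^ (k + 1) := by rw [← pow_mul, mul_comm, pow_mul]; norm_num
      have h5 : ((k + 2 : ℕ) : ℝ) ^ 2 * a ^ (k + 1) ≤ 8 * a * (1 / 2) ^ (k + 1) := by
        calc ((k + 2 : ℕ) : ℝ) ^ 2 * a ^ (k + 1) ≤ 4 ^ (k + 1) * (a * (1 / 8) ^ k) := by
              rw [pow_succ' a]; gcongr
          _ = 8 * a * (1 / 2) ^ (k + 1) := by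
              rw [show (1 / 8 : ℝ) = 1 / 4 * (1 / 2) by norm_num, mul_pow, pow_succ, pow_succ,
                one_div_pow 4]
              field_simp
              ring
      have h6 : 8 * a * (1 / 2) ^ (k + 1) = 8 * a * (1 / 2) ^ k / 2 := by rw [pow_succ]; ring
      have h7 : 8 * a * (1 - (1 / 2) ^ (k + 1)) = 8 * a * (1 - (1 / 2) ^ k) +
        8 * a * (1 / 2) ^ (k + 1) := by rw [pow_succ]; ring
      rw [h7]
      exact add_le_add ih h5
  rcases K.eq_zero_or_pos with rfl | hK
  · simpa using h0
  · obtain ⟨k, rfl⟩ : ∃ k, K = k + 1 := ⟨K - 1, by omega⟩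
    refine (key k).trans ?_
    have : (0 : ℝ) ≤ 8 * a * (1 / 2) ^ k := by positivity
    linarith

variable (B) in
-- The common estimate for both tests: `W` is the size of a first stage, `a` the type-I level per
-- stage, and `q` the growth of the totals, `2` for ST and `1` for mod-ST.
lemma ess_thresholding_le_of_le (hK : 1 ≤ K) (hM : Monotone M)
    (hS : ∀ j, 1 ≤ j → Measurable[past 𝓧 (M j)] (S j)) {p a W : ℝ} {q : ℕ}
    (hp : p ∈ Icc (0 : ℝ) 1) (ha0 : 0 ≤ a) (ha : a ≤ 1 / 8) (hW : 0 ≤ W) (hq : q ≤ 2)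
    (hMW : ∀ j, 1 ≤ j → (M j : ℝ) ≤ (j : ℝ) ^ q * W)
    (hpass : ∀ j ≤ K, (B.P 0).real (passSet b S j) ≤ a ^ j) :
    B.ess p (thresholding K M b S).1 ≤ ENNReal.ofReal (W * (1 + 8 * a + p * (K : ℝ) ^ q)) := by
  refine (B.ess_thresholding_le hK hM hS hp).trans (ENNReal.ofReal_le_ofReal ?_)
  have h1 : (M 1 : ℝ) ≤ W := by simpa using hMW 1 le_rfl
  have h2 : p * (M K : ℝ) ≤ W * (p * (K : ℝ) ^ q) := by
    rw [mul_left_comm, mul_comm W]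
    exact mul_le_mul_of_nonneg_left (hMW K hK) hp.1
  have h3 : ∑ j ∈ Finset.Icc 2 K, M j * (B.P 0).real (passSet b S (j - 1)) ≤ W * (8 * a) := by
    calc _ ≤ ∑ j ∈ Finset.Icc 2 K, W * ((j : ℝ) ^ 2 * a ^ (j - 1)) := by
          refine Finset.sum_le_sum fun j hj => ?_
          rw [Finset.mem_Icc] at hj
          have hj1 : (1 : ℝ) ≤ j := by exact_mod_cast (show 1 ≤ j by omega)
          calc _ ≤ ((j : ℝ) ^ q * W) * a ^ (j - 1) := by
                gcongr
                · exact hMW j (by omega)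
                · exact hpass _ (by omega)
            _ ≤ ((j : ℝ) ^ 2 * W) * a ^ (j - 1) := by gcongr
            _ = _ := by ring
      _ ≤ W * (8 * a) := by
          rw [← Finset.mul_sum]
          exact mul_le_mul_of_nonneg_left (sum_sq_mul_pow_le ha0 ha K) hW
  linarith

end thresholding

/-! ### Error levels of the stages -/

lemma sum_Icc_two_pow_le {x : ℝ} (h0 : 0 ≤ x) (h1 : x ≤ 1 / 2) (K : ℕ) :
    ∑ i ∈ Finset.Icc 2 K, x ^ i ≤ x := by
  -- The subtracted power pays for the next term, because `x ≤ 1 / 2`.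
  have key : ∀ k : ℕ, ∑ i ∈ Finset.Icc 2 (k + 1), x ^ i ≤ x - x ^ (k + 1) := by
    intro k
    induction k with
    | zero => simp
    | succ k ih =>
      rw [Finset.sum_Icc_succ_top (by omega)]
      have : x ^ (k + 2) ≤ x ^ (k + 1) * (1 / 2) := by rw [pow_succ]; gcongr
      linarith
  rcases K.eq_zero_or_pos with rfl | hK
  · simpa using h0
  · obtain ⟨k, rfl⟩ : ∃ k, K = k + 1 := ⟨K - 1, by omega⟩
    exact (key k).trans (by linarith [pow_nonneg h0 (k + 1)])

/-- The corrections taken from `β` in the first stage sum to at most `β / 2`, so all stages can be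
treated as having level `(β / 2) ^ j`. -/
lemma le_stageBeta {β : ℝ} (hβ : β ∈ Ioo (0 : ℝ) 1) (K j : ℕ) :
    (β / 2) ^ j ≤ stageBeta K β j := by
  rw [stageBeta]
  split_ifs with h
  · have := sum_Icc_two_pow_le (x := β / 2) (by linarith [hβ.1]) (by linarith [hβ.2]) K
    rw [h, pow_one]
    linarith
  · exact le_rfl

lemma stageBeta_pos {β : ℝ} (hβ : β ∈ Ioo (0 : ℝ) 1) (K j : ℕ) : 0 < stageBeta K β j :=
  (pow_pos (half_pos hβ.1) j).trans_le (le_stageBeta hβ K j)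

lemma sum_stageBeta {K : ℕ} (hK : 1 ≤ K) (β : ℝ) :
    ∑ j ∈ Finset.Icc 1 K, stageBeta K β j = β := by
  rw [← Finset.add_sum_Ioc_eq_sum_Icc hK, stageBeta, if_pos rfl]
  have : ∑ j ∈ Finset.Ioc 1 K, stageBeta K β j = ∑ j ∈ Finset.Icc 2 K, (β / 2) ^ j := by
    refine Finset.sum_congr (by ext; simp; omega) fun j hj => ?_
    rw [Finset.mem_Icc] at hj
    rw [stageBeta, if_neg (by omega)]
  rw [this]
  ring

lemma rpow_one_div_pow {α : ℝ} (hα : 0 ≤ α) (K j : ℕ) :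
    (α ^ (1 / (K : ℝ))) ^ j = α ^ ((j : ℝ) / (K : ℝ)) := by
  rw [← Real.rpow_natCast, ← Real.rpow_mul hα]
  ring_nf

/-- If `L` observations reach the level `x` at rate `r`, then `j * L` of them reach `x ^ j`; hence
one `L` serves every stage. -/
lemma exp_neg_le_pow {r x L n : ℝ} (hr : 0 ≤ r) (hx : 0 < x) (h : -Real.log x ≤ r * L) {j : ℕ}
    (hn : j * L ≤ n) : Real.exp (-(r * n)) ≤ x ^ j := by
  rw [← Real.exp_log (pow_pos hx j), Real.log_pow]
  refine Real.exp_le_exp.2 ?_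
  have h1 : r * (j * L) ≤ r * n := mul_le_mul_of_nonneg_left hn hr
  have h2 : (j : ℝ) * -Real.log x ≤ j * (r * L) := mul_le_mul_of_nonneg_left h (by positivity)
  linarith

/-! ### Sequential Thresholding -/

variable (B) in
/-- Later blocks of observations are independent of the past and distributed as the first ones. -/
lemma measure_inter_block (i : Fin 2) {M : ℕ} (n : ℕ) {A : Set (ℕ → 𝓧)}
    (hA : MeasurableSet[past 𝓧 M] A) {C : Set ℝ} (hC : MeasurableSet C) :
    (B.P i).real ({ω | B.llr (M + n) ω - B.llr M ω ∈ C} ∩ A) =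
      (B.P i).real {ω | B.llr n ω ∈ C} * (B.P i).real A := by
  obtain ⟨S, hS, rfl⟩ := hA
  have hind := (B.iIndepFun_eval i).indepFun_finset (Finset.Ico M (M + n)) (Finset.range M)
    (by rw [Finset.disjoint_left]; intro k; simp; omega) fun k => measurable_pi_apply k
  have hind' := hind.comp (φ := fun x => ∑ k, B.logRatio (x k))
    (ψ := fun x (k : Fin M) => x ⟨k, Finset.mem_range.2 k.2⟩) (by fun_prop) (by fun_prop)
  have hblock : ((fun x : (Finset.Ico M (M + n) → 𝓧) => ∑ k, B.logRatio (x k)) ∘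
      fun (ω : ℕ → 𝓧) (k : Finset.Ico M (M + n)) => ω k) =
      fun ω => B.llr (M + n) ω - B.llr M ω := by
    ext ω
    rw [llr_eq, llr_eq, ← Finset.sum_Ico_eq_sub _ (by omega)]
    exact Finset.sum_coe_sort (Finset.Ico M (M + n)) fun k => B.logRatio (ω k)
  rw [hblock] at hind'
  have h1 := hind'.measure_inter_preimage_eq_mul C S hC hS
  have h2 : B.P i {ω | B.llr (M + n) ω - B.llr M ω ∈ C} = B.P i {ω | B.llr n ω ∈ C} := by
    -- The i.i.d. law is invariant under deleting the first `M` observations.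
    have hshift : (B.P i).map (fun (ω : ℕ → 𝓧) k => ω (M + k)) = B.P i :=
      Measure.map_infinitePi_infinitePi_of_inj (add_right_injective M) (P := fun _ : ℕ => B.law i)
    have hm : MeasurableSet {ω | B.llr n ω ∈ C} := B.measurable_llr n hC
    conv_rhs => rw [← hshift, Measure.map_apply (by fun_prop) hm]
    congr 1
    ext ω
    have : B.llr (M + n) ω - B.llr M ω = B.llr n fun k => ω (M + k) := by
      simp_rw [llr_eq, Finset.sum_range_add_sub_sum_range]
    simp only [mem_ofPred_eq, mem_preimage, this]
  rw [measureReal_def, measureReal_def, measureReal_def, ← ENNReal.toReal_mul, ← h2]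
  exact congrArg ENNReal.toReal h1

variable (B) in
/-- The statistic of stage `j` of ST. -/
noncomputable def stStat (K : ℕ) (α β : ℝ) (j : ℕ) (ω : ℕ → 𝓧) : ℝ :=
  (B.llr (B.stTotal K α β j) ω - B.llr (B.stTotal K α β (j - 1)) ω) / (B.stSize K α β j : ℝ)

variable (B) in
lemma monotone_stTotal (K : ℕ) (α β : ℝ) : Monotone (B.stTotal K α β) := fun _ _ h =>
  Finset.sum_le_sum_of_subset (Finset.Icc_subset_Icc_right h)

variable (B) in
lemma stTotal_succ (K : ℕ) (α β : ℝ) (j : ℕ) :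
    B.stTotal K α β (j + 1) = B.stTotal K α β j + B.stSize K α β (j + 1) := by
  rw [stTotal, Finset.sum_Icc_succ_top (by omega), stTotal]

variable (B) in
lemma measurable_stStat (K : ℕ) (α β : ℝ) (j : ℕ) :
    Measurable[past 𝓧 (B.stTotal K α β j)] (B.stStat K α β j) :=
  ((B.measurable_llr_past le_rfl).sub (B.measurable_llr_past
    (B.monotone_stTotal K α β (Nat.sub_le j 1)))).div_const _

variable (B) in
lemma measure_stStat_inter (i : Fin 2) (K : ℕ) (α β : ℝ) (j : ℕ) {A : Set (ℕ → 𝓧)}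
    (hA : MeasurableSet[past 𝓧 (B.stTotal K α β j)] A) {C : Set ℝ} (hC : MeasurableSet C) :
    (B.P i).real ({ω | B.stStat K α β (j + 1) ω ∈ C} ∩ A) =
      (B.P i).real {ω | B.avgLlr (B.stSize K α β (j + 1)) ω ∈ C} * (B.P i).real A := by
  have hC' : MeasurableSet ((fun x : ℝ => x / (B.stSize K α β (j + 1) : ℝ)) ⁻¹' C) :=
    (measurable_id.div_const _) hC
  have := B.measure_inter_block i (B.stSize K α β (j + 1)) hA hC'
  rwa [← stTotal_succ] at this

section levels

variable {K : ℕ} {α β : ℝ}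

lemma SeparatesAt.stSize_spec (h : B.SeparatesAt J κ) (hJ : 0 < J) (hκ : 0 < κ)
    (hα : α ∈ Ioo (0 : ℝ) 1) (hβ : β ∈ Ioo (0 : ℝ) 1) (j : ℕ) : 1 ≤ B.stSize K α β j ∧
    (B.P 0).real {ω | B.stThr K α β j < (B.avgLlr (B.stSize K α β j) ω : EReal)} ≤
      α ^ (1 / (K : ℝ)) ∧
    (B.P 1).real {ω | (B.avgLlr (B.stSize K α β j) ω : EReal) ≤ B.stThr K α β j} ≤
      stageBeta K β j :=
  h.fssSize_spec hJ hκ (Real.rpow_pos_of_pos hα.1 _) (stageBeta_pos hβ K j)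

/-- Each stage uses fresh observations, so by independence it contributes another factor at most `α
^ (1 / K)`. -/
lemma SeparatesAt.measure_passSet_st_le (h : B.SeparatesAt J κ) (hJ : 0 < J) (hκ : 0 < κ)
    (hα : α ∈ Ioo (0 : ℝ) 1) (hβ : β ∈ Ioo (0 : ℝ) 1) (j : ℕ) :
    (B.P 0).real (passSet (B.stThr K α β) (B.stStat K α β) j) ≤ (α ^ (1 / (K : ℝ))) ^ j := by
  have ha : 0 ≤ α ^ (1 / (K : ℝ)) := Real.rpow_nonneg hα.1.le _
  induction j with
  | zero => simp
  | succ j ih =>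
    have hC : MeasurableSet {x : ℝ | B.stThr K α β (j + 1) < (x : EReal)} :=
      measurable_coe_real_ereal measurableSet_Ioi
    have := B.measure_stStat_inter 0 K α β j (measurableSet_passSet (B.monotone_stTotal K α β)
      (fun j _ => B.measurable_stStat K α β j) (le_refl (B.stTotal K α β j))
      (b := B.stThr K α β)) hC
    rw [passSet_inter, inter_comm, pow_succ']
    refine this.le.trans ?_
    gcongr
    exact (h.stSize_spec hJ hκ hα hβ (j + 1)).2.1

lemma SeparatesAt.stTest_mem_testClass (h : B.SeparatesAt J κ) (hJ : 0 < J) (hκ : 0 < κ)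
    (hα : α ∈ Ioo (0 : ℝ) 1) (hβ : β ∈ Ioo (0 : ℝ) 1) (hK : 1 ≤ K) :
    B.stTest K α β ∈ B.testClass α β := by
  refine B.thresholding_mem_testClass hK ?_ (B.monotone_stTotal K α β)
    (fun j _ => B.measurable_stStat K α β j) ?_ ?_
  · simpa [stTotal] using (h.stSize_spec hJ hκ hα hβ 1).1
  · refine (h.measure_passSet_st_le hJ hκ hα hβ K).trans ?_
    rw [rpow_one_div_pow hα.1.le, div_self (by positivity), Real.rpow_one]
  · refine le_trans (Finset.sum_le_sum fun j hj => ?_) (sum_stageBeta hK β).le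
    obtain ⟨k, rfl⟩ : ∃ k, j = k + 1 := ⟨j - 1, by rw [Finset.mem_Icc] at hj; omega⟩
    have hC : MeasurableSet {x : ℝ | (x : EReal) ≤ B.stThr K α β (k + 1)} :=
      measurable_coe_real_ereal measurableSet_Iic
    have := B.measure_stStat_inter 1 K α β k MeasurableSet.univ hC
    rw [inter_univ, probReal_univ, mul_one] at this
    exact this.le.trans (h.stSize_spec hJ hκ hα hβ (k + 1)).2.2

variable {L : ℝ}

lemma SeparatesAt.stSize_le (h : B.SeparatesAt J κ) (hJ : 0 < J) (hκ : 0 < κ)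
    (hα : α ∈ Ioo (0 : ℝ) 1) (hβ : β ∈ Ioo (0 : ℝ) 1) (hL : 0 < L)
    (hLα : -Real.log (α ^ (1 / (K : ℝ))) ≤ κ * L) (hLβ : -Real.log (β / 2) ≤ J * L)
    {j : ℕ} (hj : 1 ≤ j) : B.stSize K α β j ≤ ⌈j * L⌉₊ := by
  have hj' : (0 : ℝ) < j := by positivity
  have ha : 0 < α ^ (1 / (K : ℝ)) := Real.rpow_pos_of_pos hα.1 _
  refine h.fssSize_le (Nat.ceil_pos.2 (by positivity)) ?_ ?_
  -- The type-I level of ST is `α ^ (1 / K)` in every stage, so its `j`-th power is more than is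
  -- needed.
  · refine (exp_neg_le_pow hκ.le ha hLα (Nat.le_ceil _)).trans ?_
    exact pow_le_of_le_one ha.le (Real.rpow_le_one hα.1.le hα.2.le (by positivity)) (by omega)
  · exact (exp_neg_le_pow hJ.le (half_pos hβ.1) hLβ (Nat.le_ceil _)).trans (le_stageBeta hβ K j)

lemma natCast_ceil_mul_le {L : ℝ} (hL : 0 < L) {j : ℕ} (hj : 1 ≤ j) :
    (⌈j * L⌉₊ : ℝ) ≤ j * (L + 1) := by
  have : (1 : ℝ) ≤ j := by exact_mod_cast hj
  have := Nat.ceil_lt_add_one (a := j * L) (by positivity)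
  linarith

/-- There are `j` separate blocks of size at most `j * (L + 1)`; this quadratic growth is the source
of the square root in the condition for ST. -/
lemma SeparatesAt.stTotal_le (h : B.SeparatesAt J κ) (hJ : 0 < J) (hκ : 0 < κ)
    (hα : α ∈ Ioo (0 : ℝ) 1) (hβ : β ∈ Ioo (0 : ℝ) 1) (hL : 0 < L)
    (hLα : -Real.log (α ^ (1 / (K : ℝ))) ≤ κ * L) (hLβ : -Real.log (β / 2) ≤ J * L) (j : ℕ) :
    (B.stTotal K α β j : ℝ) ≤ (j : ℝ) ^ 2 * (L + 1) := by
  rw [stTotal, Nat.cast_sum]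
  calc ∑ i ∈ Finset.Icc 1 j, (B.stSize K α β i : ℝ) ≤ ∑ i ∈ Finset.Icc 1 j, (j : ℝ) * (L + 1) := by
        refine Finset.sum_le_sum fun i hi => ?_
        rw [Finset.mem_Icc] at hi
        have h1 : (B.stSize K α β i : ℝ) ≤ ⌈i * L⌉₊ :=
          Nat.cast_le.2 (h.stSize_le hJ hκ hα hβ hL hLα hLβ hi.1)
        refine h1.trans ((natCast_ceil_mul_le hL hi.1).trans ?_)
        gcongr
        exact hi.2
    _ = (j : ℝ) ^ 2 * (L + 1) := by simp; ring

lemma SeparatesAt.ess_stTest_le (h : B.SeparatesAt J κ) (hJ : 0 < J) (hκ : 0 < κ)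
    (hα : α ∈ Ioo (0 : ℝ) 1) (hβ : β ∈ Ioo (0 : ℝ) 1) (hK : 1 ≤ K) (hL : 0 < L)
    (hLα : -Real.log (α ^ (1 / (K : ℝ))) ≤ κ * L) (hLβ : -Real.log (β / 2) ≤ J * L)
    (ha : α ^ (1 / (K : ℝ)) ≤ 1 / 8) {p : ℝ} (hp : p ∈ Icc (0 : ℝ) 1) :
    B.ess p (B.stTest K α β).1 ≤
      ENNReal.ofReal ((L + 1) * (1 + 8 * α ^ (1 / (K : ℝ)) + p * (K : ℝ) ^ 2)) :=
  B.ess_thresholding_le_of_le hK (B.monotone_stTotal K α β)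
    (fun j _ => B.measurable_stStat K α β j) hp (Real.rpow_nonneg hα.1.le _) ha (by linarith)
    le_rfl (fun j _ => h.stTotal_le hJ hκ hα hβ hL hLα hLβ j)
    fun j _ => h.measure_passSet_st_le hJ hκ hα hβ j

/-! ### Modified Sequential Thresholding -/

/-- Dropping the event `A` only enlarges the first probability, so large fixed samples are feasible
and the least size and threshold are attained. -/
lemma SeparatesAt.nextSize_spec (h : B.SeparatesAt J κ) (hJ : 0 < J) (hκ : 0 < κ) (M : ℕ)
    (A : Set (ℕ → 𝓧)) {a b : ℝ} (ha : 0 < a) (hb : 0 < b) {N : ℕ}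
    (hN : N = M + B.nextSize M A a b) :
    (B.P 0).real ({ω | B.nextThr N A a b < (B.avgLlr N ω : EReal)} ∩ A) ≤ a ∧
      (B.P 1).real {ω | (B.avgLlr N ω : EReal) ≤ B.nextThr N A a b} ≤ b := by
  obtain ⟨n, c, h1, h2⟩ := (((tendsto_add_atTop_nat M).eventually
    (h.eventually_exists hJ hκ ha hb))).exists
  obtain ⟨c', h4⟩ := Nat.sInf_mem (s := {n : ℕ | ∃ c : ℝ,
    (B.P 0).real ({ω | c < B.avgLlr (M + n) ω} ∩ A) ≤ a ∧
    (B.P 1).real {ω | B.avgLlr (M + n) ω ≤ c} ≤ b})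
    ⟨n, c, (measureReal_mono inter_subset_left).trans (by rwa [add_comm]), by rwa [add_comm]⟩
  have hne : {c : EReal | (B.P 0).real ({ω | c < (B.avgLlr N ω : EReal)} ∩ A) ≤ a ∧
      (B.P 1).real {ω | (B.avgLlr N ω : EReal) ≤ c} ≤ b}.Nonempty :=
    ⟨(c' : EReal), by
      simp only [mem_ofPred_eq, EReal.coe_lt_coe_iff, EReal.coe_le_coe_iff]
      rw [hN]
      exact h4⟩
  exact sInf_threshold_mem (μ := B.P 0) (μ' := B.P 1) (a := a) (b := b) (B.avgLlr N) A rfl hne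

lemma SeparatesAt.nextSize_le (h : B.SeparatesAt J κ) {M n : ℕ} (A : Set (ℕ → 𝓧)) {a b : ℝ}
    (ha : Real.exp (-(κ * (M + n : ℕ))) ≤ a) (hb : Real.exp (-(J * (M + n : ℕ))) ≤ b) :
    B.nextSize M A a b ≤ n :=
  Nat.sInf_le ⟨-J, (measureReal_mono inter_subset_left).trans ((h _).1.trans ha),
    (h _).2.trans hb⟩

variable (B) in
/-- The statistic of stage `j` of mod-ST. -/
noncomputable def modStStat (K : ℕ) (α β : ℝ) (j : ℕ) : (ℕ → 𝓧) → ℝ :=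
  B.avgLlr (B.modStage K α β j).total

variable (B) in
lemma monotone_modStage_total (K : ℕ) (α β : ℝ) :
    Monotone fun j => (B.modStage K α β j).total := by
  refine monotone_nat_of_le_succ fun j => ?_
  match j with
  | 0 => exact Nat.zero_le _
  | j + 1 => exact Nat.le_add_right _ _

variable (B) in
-- Matches the event carried by the recursion with the one used for general stagewise tests.
lemma modStage_passed (K : ℕ) (α β : ℝ) (j : ℕ) : (B.modStage K α β j).passed =
    passSet (fun j => (B.modStage K α β j).thr) (B.modStStat K α β) j := by
  induction j with
  | zero => rw [passSet_zero]; rfl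
  | succ j ih =>
    rw [passSet_inter, ← ih]
    match j with
    | 0 => exact (univ_inter _).symm
    | j + 1 => exact inter_comm _ _

lemma SeparatesAt.modStage_spec (h : B.SeparatesAt J κ) (hJ : 0 < J) (hκ : 0 < κ)
    (hα : α ∈ Ioo (0 : ℝ) 1) (hβ : β ∈ Ioo (0 : ℝ) 1) (j : ℕ) :
    (B.P 0).real (B.modStage K α β (j + 1)).passed ≤ (α ^ (1 / (K : ℝ))) ^ (j + 1) ∧
    (B.P 1).real {ω | (B.modStStat K α β (j + 1) ω : EReal) ≤ (B.modStage K α β (j + 1)).thr} ≤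
      stageBeta K β (j + 1) := by
  match j with
  | 0 =>
    rw [zero_add, pow_one]
    exact (h.stSize_spec hJ hκ hα hβ 1).2
  | j + 1 =>
    rw [rpow_one_div_pow hα.1.le]
    exact h.nextSize_spec hJ hκ _ (B.modStage K α β (j + 1)).passed
      (Real.rpow_pos_of_pos hα.1 _) (stageBeta_pos hβ K (j + 2)) rfl

lemma SeparatesAt.measure_passSet_modSt_le (h : B.SeparatesAt J κ) (hJ : 0 < J) (hκ : 0 < κ)
    (hα : α ∈ Ioo (0 : ℝ) 1) (hβ : β ∈ Ioo (0 : ℝ) 1) (j : ℕ) :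
    (B.P 0).real (passSet (fun j => (B.modStage K α β j).thr) (B.modStStat K α β) j) ≤
      (α ^ (1 / (K : ℝ))) ^ j := by
  match j with
  | 0 => simp
  | j + 1 =>
    rw [← modStage_passed]
    exact (h.modStage_spec hJ hκ hα hβ j).1

lemma SeparatesAt.modStTest_mem_testClass (h : B.SeparatesAt J κ) (hJ : 0 < J) (hκ : 0 < κ)
    (hα : α ∈ Ioo (0 : ℝ) 1) (hβ : β ∈ Ioo (0 : ℝ) 1) (hK : 1 ≤ K) :
    B.modStTest K α β ∈ B.testClass α β := by
  refine B.thresholding_mem_testClass hK ?_ (B.monotone_modStage_total K α β)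
    (fun j _ => B.measurable_avgLlr_past le_rfl) ?_ ?_
  · exact (h.stSize_spec hJ hκ hα hβ 1).1
  · refine (h.measure_passSet_modSt_le hJ hκ hα hβ K).trans ?_
    rw [rpow_one_div_pow hα.1.le, div_self (by positivity), Real.rpow_one]
  · refine le_trans (Finset.sum_le_sum fun j hj => ?_) (sum_stageBeta hK β).le
    obtain ⟨k, rfl⟩ : ∃ k, j = k + 1 := ⟨j - 1, by rw [Finset.mem_Icc] at hj; omega⟩
    exact (h.modStage_spec hJ hκ hα hβ k).2

/-- All earlier data are reused, so it suffices to top up the sample to `⌈j L⌉` in total. The growth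
in `j` is linear, and `K ≪ m / u_m` is enough for mod-ST. -/
lemma SeparatesAt.modStage_total_le (h : B.SeparatesAt J κ) (hJ : 0 < J) (hκ : 0 < κ)
    (hα : α ∈ Ioo (0 : ℝ) 1) (hβ : β ∈ Ioo (0 : ℝ) 1) (hL : 0 < L)
    (hLα : -Real.log (α ^ (1 / (K : ℝ))) ≤ κ * L) (hLβ : -Real.log (β / 2) ≤ J * L) (j : ℕ) :
    (B.modStage K α β (j + 1)).total ≤ ⌈((j + 1 : ℕ) : ℝ) * L⌉₊ := by
  induction j with
  | zero =>
    rw [zero_add]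
    change B.stSize K α β 1 ≤ _
    exact h.stSize_le hJ hκ hα hβ hL hLα hLβ le_rfl
  | succ j ih =>
    set N := ⌈((j + 2 : ℕ) : ℝ) * L⌉₊ with hN
    have hle : (B.modStage K α β (j + 1)).total ≤ N := by
      refine ih.trans (Nat.ceil_mono ?_)
      gcongr
      omega
    have hsum : (B.modStage K α β (j + 1)).total + (N - (B.modStage K α β (j + 1)).total) = N :=
      Nat.add_sub_cancel' hle
    have ha : 0 < α ^ (1 / (K : ℝ)) := Real.rpow_pos_of_pos hα.1 _
    have := h.nextSize_le (M := (B.modStage K α β (j + 1)).total)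
      (n := N - (B.modStage K α β (j + 1)).total) (B.modStage K α β (j + 1)).passed
      (a := α ^ (((j + 2 : ℕ) : ℝ) / (K : ℝ))) (b := stageBeta K β (j + 2))
      (by
        rw [hsum, ← rpow_one_div_pow hα.1.le]
        exact exp_neg_le_pow hκ.le ha hLα (Nat.le_ceil _))
      (by
        rw [hsum]
        exact (exp_neg_le_pow hJ.le (half_pos hβ.1) hLβ (Nat.le_ceil _)).trans
          (le_stageBeta hβ K (j + 2)))
    calc (B.modStage K α β (j + 2)).total ≤ (B.modStage K α β (j + 1)).total +
          (N - (B.modStage K α β (j + 1)).total) := Nat.add_le_add_left this _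
      _ = N := hsum

lemma SeparatesAt.ess_modStTest_le (h : B.SeparatesAt J κ) (hJ : 0 < J) (hκ : 0 < κ)
    (hα : α ∈ Ioo (0 : ℝ) 1) (hβ : β ∈ Ioo (0 : ℝ) 1) (hK : 1 ≤ K) (hL : 0 < L)
    (hLα : -Real.log (α ^ (1 / (K : ℝ))) ≤ κ * L) (hLβ : -Real.log (β / 2) ≤ J * L)
    (ha : α ^ (1 / (K : ℝ)) ≤ 1 / 8) {p : ℝ} (hp : p ∈ Icc (0 : ℝ) 1) :
    B.ess p (B.modStTest K α β).1 ≤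
      ENNReal.ofReal ((L + 1) * (1 + 8 * α ^ (1 / (K : ℝ)) + p * (K : ℝ) ^ 1)) := by
  refine B.ess_thresholding_le_of_le hK (B.monotone_modStage_total K α β)
    (fun j _ => B.measurable_avgLlr_past le_rfl) hp (Real.rpow_nonneg hα.1.le _) ha (by linarith)
    one_le_two (fun j hj => ?_) fun j _ => h.measure_passSet_modSt_le hJ hκ hα hβ j
  obtain ⟨k, rfl⟩ : ∃ k, j = k + 1 := ⟨j - 1, by omega⟩
  rw [pow_one]
  exact (Nat.cast_le.2 (h.modStage_total_le hJ hκ hα hβ hL hLα hLβ k)).trans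
    (natCast_ceil_mul_le hL hj)

end levels

end TestingProblem

/-! ### Error levels in the high-dimensional regime -/

lemma half_le_one_sub_exp_neg {x : ℝ} (h0 : 0 ≤ x) (h1 : x ≤ 1) : x / 2 ≤ 1 - Real.exp (-x) := by
  have h2 : Real.exp (-x) ≤ (1 + x)⁻¹ := by
    rw [Real.exp_neg]
    exact inv_anti₀ (by linarith) (by linarith [Real.add_one_le_exp x])
  have h3 : x / 2 ≤ 1 - (1 + x)⁻¹ := by
    have : (1 : ℝ) - (1 + x)⁻¹ = x / (1 + x) := by field_simp; ring
    rw [this]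
    gcongr
    linarith
  linarith

/-- With `C = -log (1 - γ)` the level is `1 - exp (-C / x)`, which lies between `C / (2 x)` and `C /
x` for `x ≥ C`. -/
lemma one_sub_rpow_eq {γ x : ℝ} (hγ : γ < 1) :
    1 - (1 - γ) ^ (1 / x) = 1 - Real.exp (-(-Real.log (1 - γ) / x)) := by
  rw [Real.rpow_def_of_pos (by linarith)]
  ring_nf

lemma neg_log_one_sub_pos {γ : ℝ} (hγ : γ ∈ Ioo (0 : ℝ) 1) : 0 < -Real.log (1 - γ) :=
  neg_pos.2 (Real.log_neg (by linarith [hγ.2]) (by linarith [hγ.1]))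

lemma one_sub_rpow_mem {γ x : ℝ} (hγ : γ ∈ Ioo (0 : ℝ) 1) (hx : 0 < x) :
    1 - (1 - γ) ^ (1 / x) ∈ Ioo (0 : ℝ) 1 := by
  have h : 0 < -Real.log (1 - γ) / x := div_pos (neg_log_one_sub_pos hγ) hx
  rw [one_sub_rpow_eq hγ.2]
  have h1 : Real.exp (-(-Real.log (1 - γ) / x)) < 1 := Real.exp_lt_one_iff.2 (by linarith)
  exact ⟨by linarith, by linarith [Real.exp_pos (-(-Real.log (1 - γ) / x))]⟩

lemma one_sub_rpow_le {γ x : ℝ} (hγ : γ ∈ Ioo (0 : ℝ) 1) :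
    1 - (1 - γ) ^ (1 / x) ≤ -Real.log (1 - γ) / x := by
  rw [one_sub_rpow_eq hγ.2]
  linarith [Real.add_one_le_exp (-(-Real.log (1 - γ) / x))]

lemma le_one_sub_rpow {γ x : ℝ} (hγ : γ ∈ Ioo (0 : ℝ) 1) (hx : 0 < x)
    (h : -Real.log (1 - γ) ≤ x) : -Real.log (1 - γ) / x / 2 ≤ 1 - (1 - γ) ^ (1 / x) := by
  rw [one_sub_rpow_eq hγ.2]
  exact half_le_one_sub_exp_neg (div_nonneg (neg_log_one_sub_pos hγ).le hx.le)
    ((div_le_one hx).2 h)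

section regime

variable {l u : ℕ → ℕ} {α β : ℝ}

lemma betaM_mem (hβ : β ∈ Ioo (0 : ℝ) 1) {m : ℕ} (hu : 0 < u m) :
    betaM u β m ∈ Ioo (0 : ℝ) 1 := one_sub_rpow_mem hβ (by exact_mod_cast hu)

lemma alphaM_mem (hα : α ∈ Ioo (0 : ℝ) 1) {m : ℕ} (hl : l m < m) :
    alphaM l α m ∈ Ioo (0 : ℝ) 1 := one_sub_rpow_mem hα (by rw [sub_pos]; exact_mod_cast hl)

lemma tendsto_betaM (hβ : β ∈ Ioo (0 : ℝ) 1) (hu : Tendsto u atTop atTop) :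
    Tendsto (betaM u β) atTop (𝓝[>] 0) := by
  refine tendsto_nhdsWithin_iff.2 ⟨?_, ?_⟩
  · have h : Tendsto (fun m => -Real.log (1 - β) / (u m : ℝ)) atTop (𝓝 0) :=
      (tendsto_natCast_atTop_atTop.comp hu).const_div_atTop _
    refine squeeze_zero' ?_ (Eventually.of_forall fun m => one_sub_rpow_le hβ) h
    filter_upwards [hu.eventually_gt_atTop 0] with m hm
    exact (betaM_mem hβ hm).1.le
  · filter_upwards [hu.eventually_gt_atTop 0] with m hm
    exact (betaM_mem hβ hm).1

/-- `β_m` is of exact order `1 / u_m`, and the constants disappear on dividing logarithms by `log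
u_m → ∞`. -/
lemma tendsto_neg_log_betaM_div (hβ : β ∈ Ioo (0 : ℝ) 1) (hu : Tendsto u atTop atTop) :
    Tendsto (fun m => -Real.log (betaM u β m) / Real.log (u m)) atTop (𝓝 1) := by
  have hC := neg_log_one_sub_pos hβ
  set C := -Real.log (1 - β)
  have hu' : Tendsto (fun m => (u m : ℝ)) atTop atTop := tendsto_natCast_atTop_atTop.comp hu
  have hlog : Tendsto (fun m => Real.log (u m)) atTop atTop := Real.tendsto_log_atTop.comp hu'
  have hlim : ∀ c : ℝ, Tendsto (fun m => 1 + c / Real.log (u m)) atTop (𝓝 1) := by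
    intro c
    simpa using (hlog.const_div_atTop c).const_add 1
  refine tendsto_of_tendsto_of_tendsto_of_le_of_le' (hlim (-Real.log C)) (hlim (-Real.log (C / 2)))
    ?_ ?_
  · filter_upwards [hu'.eventually_gt_atTop 1, hu.eventually_gt_atTop 0] with m hm hm0
    have h0 : 0 < Real.log (u m) := Real.log_pos hm
    rw [le_div_iff₀ h0, add_mul, div_mul_cancel₀ _ h0.ne', one_mul]
    have h1 : Real.log (betaM u β m) ≤ Real.log (C / u m) :=
      Real.log_le_log (betaM_mem hβ hm0).1 (one_sub_rpow_le hβ)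
    rw [Real.log_div hC.ne' (by linarith)] at h1
    linarith
  · filter_upwards [hu'.eventually_gt_atTop 1, hu.eventually_gt_atTop 0,
      hu'.eventually_ge_atTop C] with m hm hm0 hmC
    have h0 : 0 < Real.log (u m) := Real.log_pos hm
    rw [div_le_iff₀ h0, add_mul, div_mul_cancel₀ _ h0.ne', one_mul]
    have h1 : Real.log (C / u m / 2) ≤ Real.log (betaM u β m) :=
      Real.log_le_log (by positivity) (le_one_sub_rpow hβ (by linarith) hmC)
    rw [div_right_comm, Real.log_div (by positivity) (by linarith)] at h1
    linarith

variable (hlu : ∀ m : ℕ, 1 ≤ m → l m ≤ u m ∧ u m ≤ m ∧ 0 < u m ∧ l m < m)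
  (hum : Tendsto (fun m : ℕ => (u m : ℝ) / (m : ℝ)) atTop (𝓝 0))
include hlu hum

lemma eventually_half_le_sub : ∀ᶠ m : ℕ in atTop, (m : ℝ) / 2 ≤ (m : ℝ) - l m := by
  filter_upwards [hum.eventually (gt_mem_nhds (show (0 : ℝ) < 1 / 2 by norm_num)),
    eventually_ge_atTop 1] with m hm hm1
  have hm1' : (0 : ℝ) < m := by exact_mod_cast hm1
  rw [div_lt_iff₀ hm1'] at hm
  have : (l m : ℝ) ≤ u m := by exact_mod_cast (hlu m hm1).1
  linarith

lemma tendsto_alphaM (hα : α ∈ Ioo (0 : ℝ) 1) : Tendsto (alphaM l α) atTop (𝓝[>] 0) := by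
  refine tendsto_nhdsWithin_iff.2 ⟨?_, ?_⟩
  · have h : Tendsto (fun m : ℕ => -Real.log (1 - α) / ((m : ℝ) - l m)) atTop (𝓝 0) := by
      refine Tendsto.const_div_atTop ?_ _
      exact tendsto_atTop_mono' _ (eventually_half_le_sub hlu hum)
        (tendsto_natCast_atTop_atTop.atTop_div_const (by norm_num))
    refine squeeze_zero' ?_ (Eventually.of_forall fun m => one_sub_rpow_le hα) h
    filter_upwards [eventually_ge_atTop 1] with m hm
    exact (alphaM_mem hα (hlu m hm).2.2.2).1.le
  · filter_upwards [eventually_ge_atTop 1] with m hm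
    exact (alphaM_mem hα (hlu m hm).2.2.2).1

lemma eventually_le_alphaM (hα : α ∈ Ioo (0 : ℝ) 1) :
    ∀ᶠ m : ℕ in atTop, -Real.log (1 - α) / 2 / m ≤ alphaM l α m := by
  have hA := neg_log_one_sub_pos hα
  have htop : Tendsto (fun m : ℕ => (m : ℝ) - l m) atTop atTop :=
    tendsto_atTop_mono' _ (eventually_half_le_sub hlu hum)
      (tendsto_natCast_atTop_atTop.atTop_div_const (by norm_num))
  filter_upwards [htop.eventually_ge_atTop (-Real.log (1 - α)), eventually_ge_atTop 1,
    htop.eventually_gt_atTop 0] with m hm hm1 hm0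
  refine le_trans ?_ (le_one_sub_rpow hα hm0 hm)
  rw [div_right_comm]
  gcongr
  linarith [(l m).cast_nonneg (α := ℝ)]

omit hum in
lemma div_mem_Icc {m s : ℕ} (hm : 1 ≤ m) (hs : s ∈ Finset.Icc (l m) (u m)) :
    (s : ℝ) / m ∈ Icc (0 : ℝ) 1 ∧ (s : ℝ) / m ≤ (u m : ℝ) / m := by
  rw [Finset.mem_Icc] at hs
  have h : (s : ℝ) ≤ u m := by exact_mod_cast hs.2
  have h' : (u m : ℝ) ≤ m := by exact_mod_cast (hlu m hm).2.1
  refine ⟨⟨by positivity, div_le_one_of_le₀ (h.trans h') (by positivity)⟩, by gcongr⟩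

variable (hu : Tendsto u atTop atTop)
include hu

lemma tendsto_alphaM_betaM (hα : α ∈ Ioo (0 : ℝ) 1) (hβ : β ∈ Ioo (0 : ℝ) 1) :
    Tendsto (fun m => (alphaM l α m, betaM u β m)) atTop (𝓝[>] 0 ×ˢ 𝓝[>] 0) :=
  (tendsto_alphaM hlu hum hα).prodMk (tendsto_betaM hβ hu)

end regime

/-! ### Asymptotic bounds in the high-dimensional regime -/

section asymptotics

variable {𝓧 : Type*} [MeasurableSpace 𝓧] {B : TestingProblem 𝓧}
  (hI : ∀ i, 0 < B.klInfo i ∧ B.klInfo i < ∞) {l u : ℕ → ℕ} {α β : ℝ}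
  (hlu : ∀ m : ℕ, 1 ≤ m → l m ≤ u m ∧ u m ≤ m ∧ 0 < u m ∧ l m < m)
  (hu : Tendsto u atTop atTop)
  (hum : Tendsto (fun m : ℕ => (u m : ℝ) / (m : ℝ)) atTop (𝓝 0))
include hlu hu hum

/-- With `L = |log (β_m / 2)| / J` the bound is asymptotic to `log u_m / J`, since `α_m ^ (1 / K_m)`
and `(u_m / m) K_m ^ q` vanish; the slack `J' < J` absorbs the error uniformly in `s`. -/
lemma eventually_ess_le {q : ℕ} {K : ℝ → ℝ → ℕ} (hK : AdmissibleStages K)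
    (hKm : Tendsto (fun m : ℕ => (u m : ℝ) / m * (K (alphaM l α m) (betaM u β m) : ℝ) ^ q)
      atTop (𝓝 0))
    (hα : α ∈ Ioo (0 : ℝ) 1) (hβ : β ∈ Ioo (0 : ℝ) 1) {J κ J' : ℝ} (hJ : 0 < J) (hκ : 0 < κ)
    (hJ' : J' < J) (hJ0' : 0 < J') {χ : ℝ → ℝ → TimeDecision 𝓧}
    (hχ : ∀ a ∈ Ioo (0 : ℝ) 1, ∀ b ∈ Ioo (0 : ℝ) 1, ∀ L : ℝ, 0 < L →
      -Real.log (a ^ (1 / (K a b : ℝ))) ≤ κ * L → -Real.log (b / 2) ≤ J * L →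
      a ^ (1 / (K a b : ℝ)) ≤ 1 / 8 → ∀ p ∈ Icc (0 : ℝ) 1, B.ess p (χ a b).1 ≤
        ENNReal.ofReal ((L + 1) * (1 + 8 * a ^ (1 / (K a b : ℝ)) + p * (K a b : ℝ) ^ q))) :
    ∀ᶠ m : ℕ in atTop, ∀ s ∈ Finset.Icc (l m) (u m),
      B.ess ((s : ℝ) / m) (χ (alphaM l α m) (betaM u β m)).1 ≤
        ENNReal.ofReal (Real.log (u m) / J') := by
  have hp := tendsto_alphaM_betaM hlu hum hu hα hβ
  have ha := hK.2.1.comp hp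
  have hκr := hK.2.2.comp hp
  have hlog : Tendsto (fun m => Real.log (u m)) atTop atTop :=
    Real.tendsto_log_atTop.comp (tendsto_natCast_atTop_atTop.comp hu)
  have hb := tendsto_neg_log_betaM_div hβ hu
  have hlim : Tendsto (fun m : ℕ => ((-Real.log (betaM u β m) / Real.log (u m) +
      Real.log 2 / Real.log (u m)) / J + 1 / Real.log (u m)) *
      (1 + 8 * alphaM l α m ^ (1 / (K (alphaM l α m) (betaM u β m) : ℝ)) +
        (u m : ℝ) / m * (K (alphaM l α m) (betaM u β m) : ℝ) ^ q)) atTop (𝓝 (1 / J)) := by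
    have := (((hb.add (hlog.const_div_atTop (Real.log 2))).div_const J).add
      (hlog.const_div_atTop 1)).mul (((ha.const_mul 8).const_add 1).add hKm)
    simpa using this
  filter_upwards [hlim.eventually (gt_mem_nhds (one_div_lt_one_div_of_lt hJ0' hJ')),
    ha.eventually (gt_mem_nhds (show (0 : ℝ) < 1 / 8 by norm_num)),
    -- The bound `κ / J` on the ratio of logarithms makes the type-I constraint hold with the same
    -- `L`.
    hκr.eventually (gt_mem_nhds (show 0 < κ / J by positivity)), hlog.eventually_gt_atTop 0,
    hu.eventually_gt_atTop 0, eventually_ge_atTop 1] with m h1 h2 h3 h4 h5 h6 s hs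
  have hαm := alphaM_mem hα (hlu m h6).2.2.2
  have hβm := betaM_mem hβ h5
  have hps := div_mem_Icc hlu h6 hs
  simp only [Function.comp_apply] at h2 h3
  have hlb : Real.log (betaM u β m) < 0 := Real.log_neg hβm.1 hβm.2
  have hlb2 : Real.log (betaM u β m / 2) = Real.log (betaM u β m) - Real.log 2 :=
    Real.log_div hβm.1.ne' two_ne_zero
  have hl2 : 0 < Real.log 2 := Real.log_pos one_lt_two
  have hLpos : 0 < -Real.log (betaM u β m / 2) / J := div_pos (by linarith) hJ
  refine (hχ _ hαm _ hβm (-Real.log (betaM u β m / 2) / J) hLpos ?_ ?_ h2.le _ hps.1).trans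
    (ENNReal.ofReal_le_ofReal ?_)
  · rw [div_lt_iff₀ (abs_pos.2 hlb.ne), abs_of_neg hlb] at h3
    refine (neg_le_abs _).trans (h3.le.trans ?_)
    rw [div_mul_eq_mul_div, mul_div_assoc]
    have : -Real.log (betaM u β m) ≤ -Real.log (betaM u β m / 2) := by linarith
    gcongr
  · rw [mul_div_cancel₀ _ hJ.ne']
  · have h7 : (-Real.log (betaM u β m / 2) / J + 1) = ((-Real.log (betaM u β m) / Real.log (u m) +
        Real.log 2 / Real.log (u m)) / J + 1 / Real.log (u m)) * Real.log (u m) := by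
      rw [hlb2]; field_simp; ring
    have h8 : 0 ≤ -Real.log (betaM u β m / 2) / J + 1 := by linarith
    calc _ ≤ (-Real.log (betaM u β m / 2) / J + 1) *
          (1 + 8 * alphaM l α m ^ (1 / (K (alphaM l α m) (betaM u β m) : ℝ)) +
          (u m : ℝ) / m * (K (alphaM l α m) (betaM u β m) : ℝ) ^ q) := by
          refine mul_le_mul_of_nonneg_left ?_ h8
          linarith [mul_le_mul_of_nonneg_right hps.2
            (show (0 : ℝ) ≤ (K (alphaM l α m) (betaM u β m) : ℝ) ^ q by positivity)]
      _ ≤ 1 / J' * Real.log (u m) := by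
          rw [h7, mul_right_comm]
          exact mul_le_mul_of_nonneg_right h1.le h4.le
      _ = Real.log (u m) / J' := by ring

include hI

lemma eventually_le_optEss (hα : α ∈ Ioo (0 : ℝ) 1) (hβ : β ∈ Ioo (0 : ℝ) 1) {J : ℝ}
    (hJ : (B.klInfo 0).toReal < J) :
    ∀ᶠ m : ℕ in atTop, ∀ s ∈ Finset.Icc (l m) (u m), ENNReal.ofReal (Real.log (u m) / J) ≤
      B.optEss ((s : ℝ) / m) (alphaM l α m) (betaM u β m) := by
  have hI0 := B.klInfo_toReal_pos hI 0
  obtain ⟨J₁, hJ₁, hJ₁J⟩ := exists_between hJ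
  obtain ⟨J₂, hJ₂, hJ₂J⟩ := exists_between hJ₁J
  have hJ₁0 : 0 < J₁ := hI0.trans hJ₁
  have hJ₂0 : 0 < J₂ := hJ₁0.trans hJ₂
  have hu' : Tendsto (fun m => (u m : ℝ)) atTop atTop := tendsto_natCast_atTop_atTop.comp hu
  have hlog : Tendsto (fun m => Real.log (u m)) atTop atTop := Real.tendsto_log_atTop.comp hu'
  -- `J₁ > I_0` lets the law of large numbers control `Λ_n`, `J₁ < J₂` makes the change of measure
  -- negligible, and `J₂ < J` leaves room for the error terms.
  set n : ℕ → ℕ := fun m => ⌊Real.log (u m) / J₂⌋₊ with hn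
  have hntop : Tendsto n atTop atTop :=
    tendsto_nat_floor_atTop.comp (hlog.atTop_div_const hJ₂0)
  have hnlim : Tendsto (fun m => (n m : ℝ) / Real.log (u m)) atTop (𝓝 J₂⁻¹) := by
    have := (tendsto_nat_floor_mul_div_atTop (inv_nonneg.2 hJ₂0.le)).comp hlog
    refine this.congr fun m => ?_
    simp only [Function.comp_apply, hn]
    rw [inv_mul_eq_div]
  have hexp : Tendsto (fun m => Real.exp (J₁ * n m) * betaM u β m) atTop (𝓝 0) := by
    have hr : 0 < 1 - J₁ / J₂ := by rw [sub_pos, div_lt_one hJ₂0]; exact hJ₂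
    have h1 : Tendsto (fun m => -Real.log (1 - β) *
        Real.exp (-((1 - J₁ / J₂) * Real.log (u m)))) atTop (𝓝 0) := by
      simpa using (Real.tendsto_exp_neg_atTop_nhds_zero.comp
        (hlog.const_mul_atTop hr)).const_mul (-Real.log (1 - β))
    refine squeeze_zero' ?_ ?_ h1
    · filter_upwards [hu.eventually_gt_atTop 0] with m hm
      exact mul_nonneg (Real.exp_pos _).le (betaM_mem hβ hm).1.le
    · filter_upwards [hu'.eventually_gt_atTop 1] with m hm
      have hm0 : (0 : ℝ) < u m := by linarith
      have h2 : J₁ * n m ≤ J₁ / J₂ * Real.log (u m) := by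
        rw [div_mul_eq_mul_div, mul_div_assoc]
        gcongr
        exact Nat.floor_le (div_nonneg (Real.log_nonneg hm.le) hJ₂0.le)
      have h3 : Real.exp (-((1 - J₁ / J₂) * Real.log (u m))) =
          Real.exp (J₁ / J₂ * Real.log (u m)) / u m := by
        rw [← Real.exp_log hm0, ← Real.exp_sub, Real.log_exp]; ring_nf
      have hC := neg_log_one_sub_pos hβ
      rw [h3]
      have hβm : 0 ≤ betaM u β m := (betaM_mem hβ (by exact_mod_cast hm0)).1.le
      calc _ ≤ Real.exp (J₁ / J₂ * Real.log (u m)) * (-Real.log (1 - β) / u m) := by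
            gcongr
            exact one_sub_rpow_le hβ
        _ = _ := by ring
  have hP := (TestingProblem.tendsto_measureReal_llr_lt hI hJ₁).comp hntop
  have ha : Tendsto (alphaM l α) atTop (𝓝 0) :=
    (tendsto_nhdsWithin_iff.1 (tendsto_alphaM hlu hum hα)).1
  have hlim1 : Tendsto (fun m => 1 - alphaM l α m - Real.exp (J₁ * n m) * betaM u β m -
      (B.P 0).real {ω | B.llr (n m) ω < -(J₁ * n m)}) atTop (𝓝 1) := by
    simpa using ((ha.const_sub 1).sub hexp).sub hP
  have hlim : Tendsto (fun m => (1 - (u m : ℝ) / m) * ((n m : ℝ) / Real.log (u m) *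
      (1 - alphaM l α m - Real.exp (J₁ * n m) * betaM u β m -
      (B.P 0).real {ω | B.llr (n m) ω < -(J₁ * n m)}))) atTop (𝓝 J₂⁻¹) := by
    simpa using (hum.const_sub 1).mul (hnlim.mul hlim1)
  filter_upwards [hlim.eventually (lt_mem_nhds (inv_strictAnti₀ hJ₂0 hJ₂J)),
    hlim1.eventually (lt_mem_nhds (zero_lt_one' ℝ)), hlog.eventually_gt_atTop 0,
    eventually_ge_atTop 1] with m h1 h2 h3 h4 s hs
  have hps := div_mem_Icc hlu h4 hs
  refine le_trans (ENNReal.ofReal_le_ofReal ?_)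
    (B.le_optEss hI _ _ (J₁ * n m) (n m) hps.1.2)
  calc Real.log (u m) / J ≤ ((1 - (u m : ℝ) / m) * ((n m : ℝ) / Real.log (u m) *
      (1 - alphaM l α m - Real.exp (J₁ * n m) * betaM u β m -
      (B.P 0).real {ω | B.llr (n m) ω < -(J₁ * n m)}))) * Real.log (u m) := by
        rw [div_eq_inv_mul]
        exact mul_le_mul_of_nonneg_right h1.le h3.le
    _ = (1 - (u m : ℝ) / m) * ((n m : ℝ) * (1 - alphaM l α m - Real.exp (J₁ * n m) * betaM u β m -
      (B.P 0).real {ω | B.llr (n m) ω < -(J₁ * n m)})) := by field_simp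
    _ ≤ _ := mul_le_mul_of_nonneg_right (by linarith [hps.2])
        (mul_nonneg (Nat.cast_nonneg _) h2.le)

/-- Each ratio is at least `1` because the test competes in the infimum; the upper and lower bounds
`log u_m / J`, for `J` on either side of `I_0`, squeeze the maximum to `1`. -/
lemma highDimOptimal_of_forall_lt {χ : ℝ → ℝ → TimeDecision 𝓧}
    (hmem : ∀ α ∈ Ioo (0 : ℝ) 1, ∀ β ∈ Ioo (0 : ℝ) 1, χ α β ∈ B.testClass α β)
    (hess : ∀ α ∈ Ioo (0 : ℝ) 1, ∀ β ∈ Ioo (0 : ℝ) 1, ∀ J : ℝ, 0 < J → J < (B.klInfo 0).toReal →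
      ∀ᶠ m : ℕ in atTop, ∀ s ∈ Finset.Icc (l m) (u m),
        B.ess ((s : ℝ) / m) (χ (alphaM l α m) (betaM u β m)).1 ≤
          ENNReal.ofReal (Real.log (u m) / J)) : HighDimOptimal B l u χ := by
  refine ⟨hmem, fun α hα β hβ => ?_⟩
  have hI0 := B.klInfo_toReal_pos hI 0
  set I := (B.klInfo 0).toReal
  have hlog : Tendsto (fun m => Real.log (u m)) atTop atTop :=
    Real.tendsto_log_atTop.comp (tendsto_natCast_atTop_atTop.comp hu)
  refine tendsto_order.2 ⟨fun c hc => ?_, fun c hc => ?_⟩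
  -- The rates `I + 1` and `I / 2` are arbitrary: they only show that the denominator is neither `0`
  -- nor `∞`.
  · filter_upwards [eventually_le_optEss hI hlu hu hum hα hβ (show I < I + 1 by linarith),
      hess α hα β hβ (I / 2) (by linarith) (by linarith), hlog.eventually_gt_atTop 0,
      eventually_ge_atTop 1] with m h1 h2 h3 h4
    have hs : u m ∈ Finset.Icc (l m) (u m) := Finset.mem_Icc.2 ⟨(hlu m h4).1, le_rfl⟩
    refine hc.trans_le (le_trans ?_ (Finset.le_sup (f := fun s : ℕ =>
      B.ess ((s : ℝ) / m) (χ (alphaM l α m) (betaM u β m)).1 /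
        B.optEss ((s : ℝ) / m) (alphaM l α m) (betaM u β m)) hs))
    have hle := B.optEss_le (p := (u m : ℝ) / m)
      (hmem _ (alphaM_mem hα (hlu m h4).2.2.2) _ (betaM_mem hβ (hlu m h4).2.2.1))
    have hpos : B.optEss ((u m : ℝ) / m) (alphaM l α m) (betaM u β m) ≠ 0 := by
      refine ne_of_gt (lt_of_lt_of_le ?_ (h1 _ hs))
      exact ENNReal.ofReal_pos.2 (by positivity)
    have htop : B.optEss ((u m : ℝ) / m) (alphaM l α m) (betaM u β m) ≠ ∞ :=
      ne_top_of_le_ne_top ENNReal.ofReal_ne_top (hle.trans (h2 _ hs))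
    rw [ENNReal.le_div_iff_mul_le (Or.inl hpos) (Or.inl htop), one_mul]
    exact hle
  · obtain ⟨r, hr0, hr1, hrc⟩ := ENNReal.lt_iff_exists_real_btwn.1 hc
    have hr : 1 < r := by simpa using hr1
    -- Then `J₁ < I < r * J₁`, and the two bounds at these rates differ by the factor `r`.
    obtain ⟨J₁, h1, h2⟩ : ∃ J₁, I / r < J₁ ∧ J₁ < I := exists_between (div_lt_self hI0 hr)
    have hJ₁ : 0 < J₁ := lt_trans (by positivity) h1
    have h3 : I < r * J₁ := by rw [div_lt_iff₀ (by linarith)] at h1; linarith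
    filter_upwards [eventually_le_optEss hI hlu hu hum hα hβ h3, hess α hα β hβ J₁ hJ₁ h2]
      with m h4 h5
    refine lt_of_le_of_lt (Finset.sup_le fun s hs => ?_) hrc
    refine ENNReal.div_le_of_le_mul ((h5 s hs).trans ?_)
    refine le_trans ?_ (mul_le_mul_right (h4 s hs) _)
    rw [← ENNReal.ofReal_mul hr0]
    refine ENNReal.ofReal_le_ofReal (le_of_eq ?_)
    field_simp

omit hI in
-- Here `x` is a `q`-th root: the square root for ST and the identity for mod-ST.
lemma tendsto_div_mul_pow {k : ℕ → ℕ} {q : ℕ} {x : ℝ → ℝ} (hx : ∀ r, 0 ≤ r → x r ^ q = r)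
    (hk : Tendsto (fun m : ℕ => (k m : ℝ) / x ((m : ℝ) / u m)) atTop (𝓝 0)) (hq : q ≠ 0) :
    Tendsto (fun m : ℕ => (u m : ℝ) / m * (k m : ℝ) ^ q) atTop (𝓝 0) := by
  have := hk.pow q
  rw [zero_pow hq] at this
  refine this.congr fun m => ?_
  rw [div_pow, hx _ (by positivity), div_div_eq_mul_div, mul_comm, mul_div_right_comm]

lemma eventually_ess_stTest_le {K : ℝ → ℝ → ℕ} (hK : AdmissibleStages K)
    (hKm : ∀ α ∈ Ioo (0 : ℝ) 1, ∀ β ∈ Ioo (0 : ℝ) 1,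
      Tendsto (fun m : ℕ => (K (alphaM l α m) (betaM u β m) : ℝ) / √((m : ℝ) / (u m : ℝ)))
        atTop (𝓝 0))
    (hα : α ∈ Ioo (0 : ℝ) 1) (hβ : β ∈ Ioo (0 : ℝ) 1) {J' : ℝ} (hJ0' : 0 < J')
    (hJ' : J' < (B.klInfo 0).toReal) :
    ∀ᶠ m : ℕ in atTop, ∀ s ∈ Finset.Icc (l m) (u m),
      B.ess ((s : ℝ) / m) (B.stTest (K (alphaM l α m) (betaM u β m)) (alphaM l α m)
        (betaM u β m)).1 ≤ ENNReal.ofReal (Real.log (u m) / J') := by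
  obtain ⟨J, hJ, hJI⟩ := exists_between hJ'
  obtain ⟨κ, hκ, h⟩ := B.exists_separatesAt hI hJI
  have hJ0 := hJ0'.trans hJ
  exact eventually_ess_le hlu hu hum hK (χ := fun a b => B.stTest (K a b) a b)
    (tendsto_div_mul_pow hlu hu hum (fun r hr => Real.sq_sqrt hr) (hKm α hα β hβ) two_ne_zero)
    hα hβ hJ0 hκ hJ hJ0' fun a ha b hb L hL h1 h2 h3 p hp =>
      h.ess_stTest_le hJ0 hκ ha hb (hK.1 a ha b hb) hL h1 h2 h3 hp

lemma highDimOptimal_stTest {K : ℝ → ℝ → ℕ} (hK : AdmissibleStages K)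
    (hKm : ∀ α ∈ Ioo (0 : ℝ) 1, ∀ β ∈ Ioo (0 : ℝ) 1,
      Tendsto (fun m : ℕ => (K (alphaM l α m) (betaM u β m) : ℝ) / √((m : ℝ) / (u m : ℝ)))
        atTop (𝓝 0)) :
    HighDimOptimal B l u (fun α β => B.stTest (K α β) α β) := by
  have hI0 := B.klInfo_toReal_pos hI 0
  obtain ⟨κ, hκ, h⟩ := B.exists_separatesAt hI (half_lt_self hI0)
  exact highDimOptimal_of_forall_lt hI hlu hu hum
    (fun α hα β hβ => h.stTest_mem_testClass (half_pos hI0) hκ hα hβ (hK.1 α hα β hβ))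
    fun α hα β hβ J' hJ0' hJ' =>
      eventually_ess_stTest_le hI hlu hu hum hK hKm hα hβ hJ0' hJ'

lemma highDimOptimal_modStTest {K : ℝ → ℝ → ℕ} (hK : AdmissibleStages K)
    (hKm : ∀ α ∈ Ioo (0 : ℝ) 1, ∀ β ∈ Ioo (0 : ℝ) 1,
      Tendsto (fun m : ℕ => (K (alphaM l α m) (betaM u β m) : ℝ) / ((m : ℝ) / (u m : ℝ)))
        atTop (𝓝 0)) :
    HighDimOptimal B l u (fun α β => B.modStTest (K α β) α β) := by
  have hI0 := B.klInfo_toReal_pos hI 0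
  refine highDimOptimal_of_forall_lt hI hlu hu hum ?_ ?_
  · intro α hα β hβ
    obtain ⟨κ, hκ, h⟩ := B.exists_separatesAt hI (half_lt_self hI0)
    exact h.modStTest_mem_testClass (half_pos hI0) hκ hα hβ (hK.1 α hα β hβ)
  · intro α hα β hβ J' hJ0' hJ'
    obtain ⟨J, hJ, hJI⟩ := exists_between hJ'
    obtain ⟨κ, hκ, h⟩ := B.exists_separatesAt hI hJI
    have hJ0 := hJ0'.trans hJ
    exact eventually_ess_le hlu hu hum hK (tendsto_div_mul_pow hlu hu hum (x := fun r => r)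
      (fun r _ => pow_one r) (hKm α hα β hβ) one_ne_zero) hα hβ hJ0 hκ hJ hJ0'
      fun a ha b hb L hL h1 h2 h3 p hp =>
        h.ess_modStTest_le hJ0 hκ ha hb (hK.1 a ha b hb) hL h1 h2 h3 hp

end asymptotics

/-! ### Existence of a suitable number of stages -/

/-- A sequence `t → ∞` is minorized along `x ≥ 1 / m ^ 2` by a function that tends to infinity as
`x → 0`. -/
lemma exists_tendsto_atTop_le {t : ℕ → ℝ} (ht0 : ∀ m, 0 ≤ t m) (ht : Tendsto t atTop atTop) :
    ∃ G : ℝ → ℝ, (∀ x, 0 ≤ G x) ∧ Tendsto G (𝓝[>] 0) atTop ∧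
      ∀ x (m : ℕ), 1 / x ≤ (m : ℝ) ^ 2 → G x ≤ t m := by
  -- The infimum of `t` over a tail that recedes to infinity as `x → 0`.
  refine ⟨fun x => sInf (t '' {m : ℕ | 1 / x ≤ (m : ℝ) ^ 2}), fun x => ?_, ?_, fun x m h => ?_⟩
  · exact Real.sInf_nonneg (by rintro _ ⟨m, -, rfl⟩; exact ht0 m)
  · refine tendsto_atTop.2 fun C => ?_
    obtain ⟨N, hN⟩ := eventually_atTop.1 (ht.eventually_ge_atTop C)
    have hinv : Tendsto (fun x : ℝ => 1 / x) (𝓝[>] 0) atTop := by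
      simpa using tendsto_inv_nhdsGT_zero (𝕜 := ℝ)
    filter_upwards [hinv.eventually_gt_atTop ((N : ℝ) ^ 2)] with x hx
    refine le_csInf ?_ ?_
    · obtain ⟨m, hm⟩ := ((tendsto_pow_atTop two_ne_zero).comp
        (tendsto_natCast_atTop_atTop (R := ℝ))).eventually_ge_atTop (1 / x) |>.exists
      exact ⟨t m, m, hm, rfl⟩
    · rintro _ ⟨m, hm, rfl⟩
      refine hN m ?_
      have : (N : ℝ) ^ 2 < (m : ℝ) ^ 2 := hx.trans_le hm
      exact_mod_cast (lt_of_pow_lt_pow_left₀ 2 (by positivity) this).le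
  · exact csInf_le ⟨0, by rintro _ ⟨m, -, rfl⟩; exact ht0 m⟩ ⟨m, h, rfl⟩

/-- Numbers of stages `K ≈ (1 + |log α| / |log β|) g` with `g → ∞`, `g ≪ |log α|` and
`g ≪ |log β|` are admissible. -/
lemma admissibleStages_of_tendsto {K : ℝ → ℝ → ℕ} {g : ℝ → ℝ → ℝ}
    (h1 : ∀ α β, 1 ≤ K α β)
    (hg : Tendsto (fun p : ℝ × ℝ => g p.1 p.2) (𝓝[>] 0 ×ˢ 𝓝[>] 0) atTop)
    (hgα : ∀ α β, g α β ≤ √|Real.log α|) (hgβ : ∀ α β, g α β ≤ √|Real.log β|)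
    (hl : ∀ α β, (1 + |Real.log α| / |Real.log β|) * g α β ≤ K α β)
    (hu : ∀ α β, (K α β : ℝ) ≤ (1 + |Real.log α| / |Real.log β|) * g α β + 2) :
    AdmissibleStages K := by
  have hlogtop : Tendsto (fun x : ℝ => |Real.log x|) (𝓝[>] 0) atTop :=
    tendsto_abs_atBot_atTop.comp Real.tendsto_log_nhdsGT_zero
  have hA : Tendsto (fun p : ℝ × ℝ => |Real.log p.1|) (𝓝[>] 0 ×ˢ 𝓝[>] 0) atTop :=
    hlogtop.comp tendsto_fst
  have hB : Tendsto (fun p : ℝ × ℝ => |Real.log p.2|) (𝓝[>] 0 ×ˢ 𝓝[>] 0) atTop :=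
    hlogtop.comp tendsto_snd
  have h0 : ∀ᶠ p : ℝ × ℝ in 𝓝[>] 0 ×ˢ 𝓝[>] 0, p.1 ∈ Ioo (0 : ℝ) 1 :=
    tendsto_fst.eventually (Ioo_mem_nhdsGT one_pos)
  refine ⟨fun α _ β _ => h1 α β, ?_, ?_⟩
  -- As `α ^ (1 / K) = exp (-|log α| / K)`, it suffices that `K ≪ |log α|`; the two square-root caps
  -- on `g` control the two terms of `K`.
  · have hlim : Tendsto (fun p : ℝ × ℝ => (K p.1 p.2 : ℝ) / |Real.log p.1|)
        (𝓝[>] 0 ×ˢ 𝓝[>] 0) (𝓝 0) := by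
      have hlim' : Tendsto (fun p : ℝ × ℝ => 1 / √|Real.log p.1| + 1 / √|Real.log p.2| +
          2 / |Real.log p.1|) (𝓝[>] 0 ×ˢ 𝓝[>] 0) (𝓝 0) := by
        simpa using (((Real.tendsto_sqrt_atTop.comp hA).const_div_atTop 1).add
          ((Real.tendsto_sqrt_atTop.comp hB).const_div_atTop 1)).add (hA.const_div_atTop 2)
      refine squeeze_zero' (Eventually.of_forall fun p => by positivity) ?_ hlim'
      filter_upwards [hA.eventually_gt_atTop 0, hB.eventually_gt_atTop 0] with p hp1 hp2
      have e1 : (1 : ℝ) / √|Real.log p.1| = √|Real.log p.1| / |Real.log p.1| := by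
        rw [Real.sqrt_div_self']
      have e2 : (1 : ℝ) / √|Real.log p.2| = √|Real.log p.2| / |Real.log p.2| := by
        rw [Real.sqrt_div_self']
      rw [e1, e2]
      calc (K p.1 p.2 : ℝ) / |Real.log p.1| ≤
            ((1 + |Real.log p.1| / |Real.log p.2|) * g p.1 p.2 + 2) / |Real.log p.1| := by
              gcongr; exact hu _ _
        _ = g p.1 p.2 / |Real.log p.1| + g p.1 p.2 / |Real.log p.2| + 2 / |Real.log p.1| := by
              field_simp
        _ ≤ _ := by
              gcongr
              · exact hgα _ _
              · exact hgβ _ _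
    have hlim2 : Tendsto (fun p : ℝ × ℝ => (K p.1 p.2 : ℝ) / |Real.log p.1|)
        (𝓝[>] 0 ×ˢ 𝓝[>] 0) (𝓝[>] 0) := by
      refine tendsto_nhdsWithin_iff.2 ⟨hlim, ?_⟩
      filter_upwards [hA.eventually_gt_atTop 0] with p hp
      exact div_pos (by exact_mod_cast h1 _ _) hp
    refine (Real.tendsto_exp_neg_atTop_nhds_zero.comp
      (tendsto_inv_nhdsGT_zero.comp hlim2)).congr' ?_
    filter_upwards [h0] with p hp
    rw [Real.rpow_def_of_pos hp.1, Function.comp_apply, Function.comp_apply, inv_div,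
      abs_of_neg (Real.log_neg hp.1 hp.2)]
    ring_nf
  -- The ratio is `|log α| / (K |log β|)`, at most `1 / g` by the lower bound on `K`.
  · refine squeeze_zero' (Eventually.of_forall fun p => by positivity) ?_
      (tendsto_inv_atTop_zero.comp hg)
    filter_upwards [h0, hA.eventually_gt_atTop 0, hB.eventually_gt_atTop 0,
      hg.eventually_gt_atTop 0] with p hp hp1 hp2 hp3
    have hK : (0 : ℝ) < K p.1 p.2 := by exact_mod_cast h1 _ _
    have h2 : |Real.log p.1| / |Real.log p.2| * g p.1 p.2 ≤ K p.1 p.2 := by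
      refine le_trans ?_ (hl _ _)
      rw [add_mul]
      linarith
    rw [Real.log_rpow hp.1, abs_mul, abs_of_pos (by positivity), Function.comp_apply,
      div_le_iff₀ hp2, ← div_eq_inv_mul, le_div_iff₀ hp3, one_div_mul_eq_div, div_mul_eq_mul_div,
      div_le_iff₀ hK]
    rw [div_mul_eq_mul_div, div_le_iff₀ hp2] at h2
    linarith

section existence

variable {l u : ℕ → ℕ}
  (hlu : ∀ m : ℕ, 1 ≤ m → l m ≤ u m ∧ u m ≤ m ∧ 0 < u m ∧ l m < m)
  (hu : Tendsto u atTop atTop)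
  (hum : Tendsto (fun m : ℕ => (u m : ℝ) / (m : ℝ)) atTop (𝓝 0))
include hlu hu hum

/-- `|log α_m|` is at most `log m` plus a constant, `log m = log u_m + log (m / u_m)`, and `|log
β_m|` eventually exceeds half of `log u_m`. -/
lemma eventually_log_ratio_le {α β : ℝ} (hα : α ∈ Ioo (0 : ℝ) 1) (hβ : β ∈ Ioo (0 : ℝ) 1) :
    ∀ᶠ m : ℕ in atTop, |Real.log (alphaM l α m)| / |Real.log (betaM u β m)| ≤
      4 + 2 * Real.log ((m : ℝ) / u m) := by
  have hlog : Tendsto (fun m => Real.log (u m)) atTop atTop :=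
    Real.tendsto_log_atTop.comp (tendsto_natCast_atTop_atTop.comp hu)
  have hA := neg_log_one_sub_pos hα
  filter_upwards [eventually_le_alphaM hlu hum hα, hu.eventually_gt_atTop 0,
    (tendsto_neg_log_betaM_div hβ hu).eventually (lt_mem_nhds (show (1 / 2 : ℝ) < 1 by norm_num)),
    hlog.eventually_ge_atTop (max 1 (-Real.log (-Real.log (1 - α) / 2))), eventually_ge_atTop 1]
    with m h1 h2 h3 h4 h5
  have hm : (0 : ℝ) < m := by exact_mod_cast h5
  have hum0 : (0 : ℝ) < u m := by exact_mod_cast h2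
  have h4' := max_le_iff.1 h4
  have hαm := alphaM_mem hα (hlu m h5).2.2.2
  have hβm := betaM_mem hβ h2
  rw [abs_of_neg (Real.log_neg hαm.1 hαm.2), abs_of_neg (Real.log_neg hβm.1 hβm.2)]
  rw [lt_div_iff₀ (by linarith)] at h3
  have h6 : Real.log (-Real.log (1 - α) / 2 / m) ≤ Real.log (alphaM l α m) :=
    Real.log_le_log (by positivity) h1
  rw [Real.log_div (by positivity) hm.ne'] at h6
  have h7 : Real.log ((m : ℝ) / u m) = Real.log m - Real.log (u m) :=
    Real.log_div hm.ne' hum0.ne'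
  have h8 : 0 ≤ Real.log ((m : ℝ) / u m) := by
    refine Real.log_nonneg ((one_le_div hum0).2 ?_)
    exact_mod_cast (hlu m h5).2.1
  rw [div_le_iff₀ (by linarith)]
  have h9 : (4 + 2 * Real.log ((m : ℝ) / u m)) * (1 / 2 * Real.log (u m)) ≤
      (4 + 2 * Real.log ((m : ℝ) / u m)) * -Real.log (betaM u β m) := by
    gcongr
  have h10 : Real.log ((m : ℝ) / u m) * 1 ≤ Real.log ((m : ℝ) / u m) * Real.log (u m) := by
    gcongr
    exact h4'.1
  linarith

lemma exists_admissibleStages : ∃ K : ℝ → ℝ → ℕ, AdmissibleStages K ∧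
    ∀ α ∈ Ioo (0 : ℝ) 1, ∀ β ∈ Ioo (0 : ℝ) 1,
      Tendsto (fun m : ℕ => (K (alphaM l α m) (betaM u β m) : ℝ) / √((m : ℝ) / (u m : ℝ)))
        atTop (𝓝 0) := by
  have hr : Tendsto (fun m : ℕ => (m : ℝ) / u m) atTop atTop := by
    have : Tendsto (fun m : ℕ => (u m : ℝ) / (m : ℝ)) atTop (𝓝[>] 0) := by
      refine tendsto_nhdsWithin_iff.2 ⟨hum, ?_⟩
      filter_upwards [hu.eventually_gt_atTop 0, eventually_gt_atTop 0] with m h1 h2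
      exact mem_Ioi.2 (by positivity)
    refine (tendsto_inv_nhdsGT_zero.comp this).congr fun m => ?_
    rw [Function.comp_apply, inv_div]
  -- The exponent makes `√(m / u_m) = t ^ 4`, while `K_m = O(t ^ 2)`: one factor `t` bounds `log (m
  -- / u_m)` and the other bounds `g`.
  set t : ℕ → ℝ := fun m => ((m : ℝ) / u m) ^ (1 / 8 : ℝ) with htdef
  have ht0 : ∀ m, 0 ≤ t m := fun m => by positivity
  have ht : Tendsto t atTop atTop := (tendsto_rpow_atTop (by norm_num)).comp hr
  obtain ⟨G, hG0, hG, hGt⟩ := exists_tendsto_atTop_le ht0 ht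
  set g : ℝ → ℝ → ℝ := fun α β => min (G α) (min √|Real.log α| √|Real.log β|) with hgdef
  have hg0 : ∀ α β, 0 ≤ g α β := fun α β =>
    le_min (hG0 α) (le_min (Real.sqrt_nonneg _) (Real.sqrt_nonneg _))
  have hKu : ∀ α β, ((⌈(1 + |Real.log α| / |Real.log β|) * g α β⌉₊ + 1 : ℕ) : ℝ) ≤
      (1 + |Real.log α| / |Real.log β|) * g α β + 2 := by
    intro α β
    have := Nat.ceil_lt_add_one (a := (1 + |Real.log α| / |Real.log β|) * g α β)
      (mul_nonneg (by positivity) (hg0 α β))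
    push_cast
    linarith
  refine ⟨fun α β => ⌈(1 + |Real.log α| / |Real.log β|) * g α β⌉₊ + 1,
    admissibleStages_of_tendsto (g := g) (fun α β => by omega) ?_
      (fun α β => (min_le_right _ _).trans (min_le_left _ _))
      (fun α β => (min_le_right _ _).trans (min_le_right _ _))
      (fun α β => (Nat.le_ceil _).trans (by push_cast; linarith)) hKu, fun α hα β hβ => ?_⟩
  · have hlogtop : Tendsto (fun x : ℝ => √|Real.log x|) (𝓝[>] 0) atTop :=
      Real.tendsto_sqrt_atTop.comp (tendsto_abs_atBot_atTop.comp Real.tendsto_log_nhdsGT_zero)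
    refine tendsto_atTop.2 fun C => ?_
    filter_upwards [(hG.comp tendsto_fst).eventually_ge_atTop C,
      (hlogtop.comp tendsto_fst).eventually_ge_atTop C,
      (hlogtop.comp tendsto_snd).eventually_ge_atTop C] with p h1 h2 h3
    exact le_min h1 (le_min h2 h3)
  · have hlim : Tendsto (fun m => ((5 + 16 * t m) * t m + 2) / t m ^ 4) atTop (𝓝 0) := by
      have h1 : ∀ c : ℝ, ∀ k : ℕ, k ≠ 0 → Tendsto (fun m => c / t m ^ k) atTop (𝓝 0) :=
        fun c k hk => ((tendsto_pow_atTop hk).comp ht).const_div_atTop c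
      have h2 := ((h1 5 3 (by norm_num)).add (h1 16 2 (by norm_num))).add (h1 2 4 (by norm_num))
      simp only [add_zero] at h2
      refine h2.congr' ?_
      filter_upwards [ht.eventually_gt_atTop 0] with m hm
      field_simp
    have hA := neg_log_one_sub_pos hα
    refine squeeze_zero' (Eventually.of_forall fun m => by positivity) ?_ hlim
    filter_upwards [eventually_log_ratio_le hlu hu hum hα hβ, eventually_le_alphaM hlu hum hα,
      (tendsto_natCast_atTop_atTop (R := ℝ)).eventually_ge_atTop (1 / (-Real.log (1 - α) / 2)),
      hr.eventually_gt_atTop 0, eventually_gt_atTop 0] with m h1 h2 h3 h4 h5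
    have hm : (0 : ℝ) < m := by exact_mod_cast h5
    have hsqrt : √((m : ℝ) / u m) = t m ^ 4 := by
      rw [htdef, Real.sqrt_eq_rpow, ← Real.rpow_natCast, ← Real.rpow_mul h4.le]
      norm_num
    have hlogr : Real.log ((m : ℝ) / u m) ≤ 8 * t m := by
      have := Real.log_le_rpow_div h4.le (show (0 : ℝ) < 1 / 8 by norm_num)
      rw [div_div_eq_mul_div, div_one] at this
      linarith
    -- `α_m` is at least a constant over `m`, hence eventually at least `1 / m ^ 2`; the square
    -- absorbs the constant, so one `G` serves all `α`.
    have hgt : g (alphaM l α m) (betaM u β m) ≤ t m := by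
      refine (min_le_left _ _).trans (hGt _ _ ?_)
      calc 1 / alphaM l α m ≤ 1 / (-Real.log (1 - α) / 2 / m) :=
            one_div_le_one_div_of_le (by positivity) h2
        _ = 1 / (-Real.log (1 - α) / 2) * m := by rw [one_div_div, one_div, div_eq_inv_mul]
        _ ≤ m * m := by gcongr
        _ = (m : ℝ) ^ 2 := (sq _).symm
    rw [hsqrt]
    refine div_le_div_of_nonneg_right ((hKu _ _).trans ?_) (by positivity)
    have h6 := hg0 (alphaM l α m) (betaM u β m)
    have h7 := ht0 m
    have h8 : 1 + |Real.log (alphaM l α m)| / |Real.log (betaM u β m)| ≤ 5 + 16 * t m := by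
      linarith
    gcongr

end existence

/-! ### Proof of the corollary -/

theorem mainTheorem5 {𝓧 : Type*} [MeasurableSpace 𝓧] (B : TestingProblem 𝓧)
    (hI : ∀ i, 0 < B.klInfo i ∧ B.klInfo i < ∞)
    (l u : ℕ → ℕ)
    (hlu : ∀ m : ℕ, 1 ≤ m → l m ≤ u m ∧ u m ≤ m ∧ 0 < u m ∧ l m < m)
    (hu : Tendsto u atTop atTop)
    (hum : Tendsto (fun m : ℕ => (u m : ℝ) / (m : ℝ)) atTop (𝓝 0)) :
    -- the optimal expected average sample size
    (∀ α ∈ Ioo (0 : ℝ) 1, ∀ β ∈ Ioo (0 : ℝ) 1,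
      UniformlyEquivalent l u
        (fun m s => B.optEss ((s : ℝ) / m) (alphaM l α m) (betaM u β m))
        (fun m _ => ENNReal.ofReal (Real.log (u m) / (B.klInfo 0).toReal))) ∧
    -- ST is optimal whenever `K_m ≪ √(m / u_m)`
    (∀ K : ℝ → ℝ → ℕ, AdmissibleStages K →
      (∀ α ∈ Ioo (0 : ℝ) 1, ∀ β ∈ Ioo (0 : ℝ) 1,
        Tendsto (fun m : ℕ => (K (alphaM l α m) (betaM u β m) : ℝ) / √((m : ℝ) / (u m : ℝ)))
          atTop (𝓝 0)) →
      HighDimOptimal B l u (fun α β => B.stTest (K α β) α β)) ∧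
    -- mod-ST is optimal whenever `K_m ≪ m / u_m`
    (∀ K : ℝ → ℝ → ℕ, AdmissibleStages K →
      (∀ α ∈ Ioo (0 : ℝ) 1, ∀ β ∈ Ioo (0 : ℝ) 1,
        Tendsto (fun m : ℕ => (K (alphaM l α m) (betaM u β m) : ℝ) / ((m : ℝ) / (u m : ℝ)))
          atTop (𝓝 0)) →
      HighDimOptimal B l u (fun α β => B.modStTest (K α β) α β)) ∧
    -- such choices exist, and one choice serves both families
    (∃ K : ℝ → ℝ → ℕ, AdmissibleStages K ∧
      (∀ α ∈ Ioo (0 : ℝ) 1, ∀ β ∈ Ioo (0 : ℝ) 1,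
        Tendsto (fun m : ℕ => (K (alphaM l α m) (betaM u β m) : ℝ) / √((m : ℝ) / (u m : ℝ)))
          atTop (𝓝 0)) ∧
      HighDimOptimal B l u (fun α β => B.stTest (K α β) α β) ∧
      HighDimOptimal B l u (fun α β => B.modStTest (K α β) α β)) := by
  have hI0 := B.klInfo_toReal_pos hI 0
  obtain ⟨K, hK, hKm⟩ := exists_admissibleStages hlu hu hum
  -- Since `m / u_m ≥ 1`, it dominates its square root, so the same `K` serves mod-ST.
  have hKm' : ∀ α ∈ Ioo (0 : ℝ) 1, ∀ β ∈ Ioo (0 : ℝ) 1,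
      Tendsto (fun m : ℕ => (K (alphaM l α m) (betaM u β m) : ℝ) / ((m : ℝ) / (u m : ℝ)))
        atTop (𝓝 0) := by
    intro α hα β hβ
    refine squeeze_zero' (Eventually.of_forall fun m => by positivity) ?_ (hKm α hα β hβ)
    filter_upwards [eventually_ge_atTop 1] with m hm
    have h1 : 1 ≤ (m : ℝ) / u m := by
      rw [one_le_div (Nat.cast_pos.2 (hlu m hm).2.2.1)]
      exact_mod_cast (hlu m hm).2.1
    have h2 : √((m : ℝ) / u m) ≤ (m : ℝ) / u m := Real.sqrt_le_iff.2 ⟨by positivity, by nlinarith⟩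
    gcongr
  have hst := highDimOptimal_stTest hI hlu hu hum hK hKm
  refine ⟨fun α hα β hβ ε hε => ?_, fun K hK hKm => highDimOptimal_stTest hI hlu hu hum hK hKm,
    fun K hK hKm => highDimOptimal_modStTest hI hlu hu hum hK hKm,
    ⟨K, hK, hKm, hst, highDimOptimal_modStTest hI hlu hu hum hK hKm'⟩⟩
  have hlog : Tendsto (fun m => Real.log (u m)) atTop atTop :=
    Real.tendsto_log_atTop.comp (tendsto_natCast_atTop_atTop.comp hu)
  -- The upper bound for the optimum comes from ST with the constructed `K`. The rates `I_0 / (1 +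
  -- ε)` and `(1 + ε) I_0` give the factors `1 + ε` and `1 / (1 + ε) ≥ 1 - ε`.
  have hupper := eventually_ess_stTest_le hI hlu hu hum hK hKm hα hβ
    (J' := (B.klInfo 0).toReal / (1 + ε)) (by positivity) (div_lt_self hI0 (by linarith))
  filter_upwards [hupper, eventually_le_optEss hI hlu hu hum hα hβ
      (show (B.klInfo 0).toReal < (1 + ε) * (B.klInfo 0).toReal by nlinarith),
    hlog.eventually_gt_atTop 0, eventually_ge_atTop 1] with m h1 h2 h3 h4 s hs
  have hy : 0 < Real.log (u m) / (B.klInfo 0).toReal := div_pos h3 hI0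
  constructor
  · rw [ENNReal.le_div_iff_mul_le (Or.inl (ENNReal.ofReal_pos.2 hy).ne')
      (Or.inl ENNReal.ofReal_ne_top), ← ENNReal.ofReal_mul' hy.le]
    refine (ENNReal.ofReal_le_ofReal ?_).trans (h2 s hs)
    rw [← div_div, div_right_comm, le_div_iff₀ (by linarith)]
    nlinarith [mul_pos (mul_pos hε hε) hy]
  · refine ENNReal.div_le_of_le_mul ?_
    rw [← ENNReal.ofReal_mul (by linarith)]
    refine (TestingProblem.optEss_le (hst.1 _ (alphaM_mem hα (hlu m h4).2.2.2) _
      (betaM_mem hβ (hlu m h4).2.2.1))).trans ((h1 s hs).trans (ENNReal.ofReal_le_ofReal ?_))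
    rw [div_div_eq_mul_div, mul_comm, mul_div_assoc]
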